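/- **Proposition.** Let $M$ be a Riemann surface and let $\mathbf x : M \to \mathbb R^3$ be a smooth minimal immersion for which the complex structure and the orientation of $M$ are the induced ones. Let $g=\mathbf x^*g_E$ be the induced metric, $K_g$ its Gauss curvature, $\mathbf n$ the orientation-compatible unit normal and $A=\langle \nabla d\mathbf x,\mathbf n\rangle$ the second fundamental form. The Hopf differential $Q$ is the quadratic differential of type $(2,0)$ with $\operatorname{Re} Q=A$. Where $K_g<0$, put $\hat g=(-K_g)^{3/4}g$; the entropy form $T$ is the $\hat g$-trace-free part of the Hessian ${}^{\hat g}\nabla^2\log K_{\hat g}$, and the entropy differential $P$ is the quadratic differential of type $(2,0)$ with $\operatorname{Re} P=T$. Let $(G,\eta)$ be the Weierstrass data of $\mathbf x$: $G : M\to\mathbb C\cup\{\infty\}$ is $\mathbf n$ followed by the stereographic projection $n\mapsto \frac{n_1+i n_2}{1-n_3}$ (with $(0,0,1)\mapsto\infty$), and $\eta$ is the complex linear one-form with $\mathbf x^*dx_3=\operatorname{Re}\eta$. Let $(U,z)$ be a holomorphic coordinate chart of $M$ on which $K_g<0$, and write $\eta=h\,dz$, $G=G(z)$, $'=d/dz$.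 Then $h$ is holomorphic on $U$; $G$ is holomorphic with $G'\neq0$ at every point of $U$ that is not a pole of $G$; the zeros and poles of $G$ in $U$ are isolated, and $h\ne 0$ away from them. Moreover $P=\frac{\rho}{2}\,dz^2$ on $U$ with $\rho$ holomorphic on $U$, and $$ \rho=\frac{G'''}{G'}+\frac{G''}{2G}-\frac{3(G')^2}{4G^2}-\frac{7(G'')^2}{4(G')^2}+\frac{G''h'}{2G'h}-\frac{G'h'}{2Gh}-\frac{h''}{h}+\frac{5(h')^2}{4h^2}, $$ pointwise away from the zeros and poles of $G$, and in the sense of limits at every point of $U$. If in addition $Q=dz^2$ on $U$, then $$ P=\left(\left(\frac{G''}{G'}\right)'-\frac12\left(\frac{G''}{G'}\right)^2\right)dz^2=\{G,z\}\,dz^2,\qquad \{G,z\}=\frac{G'''}{G'}-\frac32\left(\frac{G''}{G'}\right)^2, $$ pointwise away from the poles of $G$, and in the sense of limits at every point of $U$. -/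

import Mathlib

open scoped Manifold ContDiff Topology

namespace EntropyDiff

noncomputable section

/-- Euclidean three-space. -/
abbrev E3 : Type := EuclideanSpace ℝ (Fin 3)

/-! ### Riemannian geometry in a coordinate domain

A point of a coordinate domain is `z = u + i v` in `ℂ`, with the real coordinates `(u, v)`.
A metric, or any covariant 2-tensor, is given by its matrix of components. -/

/-- The coordinate vectors: `1` is `∂/∂u` and `i` is `∂/∂v`. -/
def coordVec (i : Fin 2) : ℂ := ![1, Complex.I] i

/-- The components of a tangent vector. -/
def coord (v : ℂ) (i : Fin 2) : ℝ := ![v.re, v.im] i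

/-- The partial derivative of `f` in the `i`-th real coordinate. -/
def pd (i : Fin 2) (f : ℂ → ℝ) (z : ℂ) : ℝ := fderiv ℝ f z (coordVec i)

/-- A field of (symmetric) bilinear forms on a domain of `ℂ`, by its components. -/
abbrev TensorField : Type := ℂ → Matrix (Fin 2) (Fin 2) ℝ

/-- The bilinear form on tangent vectors with the given components. -/
def toForm (S : Matrix (Fin 2) (Fin 2) ℝ) (v w : ℂ) : ℝ :=
  ∑ i, ∑ j, S i j * coord v i * coord w j

/-- Christoffel symbols `Γ^k_{ij}` of the Levi-Civita connection of `g`. -/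
def christoffel (g : TensorField) (k i j : Fin 2) (z : ℂ) : ℝ :=
  (1 / 2) * ∑ l, (g z)⁻¹ k l *
    (pd i (fun w => g w j l) z + pd j (fun w => g w i l) z - pd l (fun w => g w i j) z)

/-- The `l`-th component of `R(∂_u, ∂_v) ∂_v`, where
`R(X, Y) Z = ∇_X ∇_Y Z - ∇_Y ∇_X Z - ∇_{[X, Y]} Z`. -/
def curvatureComp (g : TensorField) (l : Fin 2) (z : ℂ) : ℝ :=
  pd 0 (christoffel g l 1 1) z - pd 1 (christoffel g l 0 1) z
    + ∑ m, (christoffel g m 1 1 z * christoffel g l 0 m z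
      - christoffel g m 0 1 z * christoffel g l 1 m z)

/-- The (intrinsic) Gauss curvature `K_g = g(R(∂_u, ∂_v) ∂_v, ∂_u) / det g`. -/
def gaussCurvature (g : TensorField) (z : ℂ) : ℝ :=
  (∑ l, curvatureComp g l z * g z l 0) / (g z).det

/-- The Hessian `∇² f` of a function, with respect to the Levi-Civita connection of `g`. -/
def hessian (g : TensorField) (f : ℂ → ℝ) : TensorField := fun z =>
  Matrix.of fun i j => pd i (pd j f) z - ∑ k, christoffel g k i j z * pd k f z

/-- The trace of `S` with respect to `g`. -/
def metricTrace (g S : TensorField) (z : ℂ) : ℝ := ∑ i, ∑ j, (g z)⁻¹ i j * S z i j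

/-- The part of `S` that is trace-free with respect to `g`. -/
def traceFree (g S : TensorField) : TensorField := fun z =>
  S z - (metricTrace g S z / 2) • g z

/-- `V_g`, the `g`-trace-free Hessian of `log K_g`. -/
def conservedForm (g : TensorField) : TensorField :=
  traceFree g (hessian g fun z => Real.log (gaussCurvature g z))

/-- The rescaled metric `(-K_g)^{3/4} g`. -/
def rescaledMetric (g : TensorField) : TensorField := fun z =>
  ((-gaussCurvature g z) ^ (3 / 4 : ℝ)) • g z

/-- The entropy form `T` of a negatively curved metric `g`: the form `V` of the rescaled metric. -/
def entropyForm (g : TensorField) : TensorField := conservedForm (rescaledMetric g)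

/-- The quadratic differential with a given trace-free real part `S`: the complex bilinear
form `S(v, w) - i S(J v, w)`, with `J` the multiplication by `i`. For `S = Re (a dz²)` it is
`a dz²`. -/
def quadraticDifferential (S : TensorField) (z v w : ℂ) : ℂ :=
  (toForm (S z) v w : ℂ) - Complex.I * (toForm (S z) (Complex.I * v) w : ℂ)

/-- The entropy differential `P` of the metric `g`: the quadratic differential with `Re P = T`. -/
def entropyDifferential (g : TensorField) (z v w : ℂ) : ℂ :=
  quadraticDifferential (entropyForm g) z v w

/-! ### Parametrized surfaces -/

/-- The first fundamental form of a parametrization. -/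
def firstForm (X : ℂ → E3) : TensorField := fun z =>
  Matrix.of fun i j => inner ℝ (fderiv ℝ X z (coordVec i)) (fderiv ℝ X z (coordVec j))

/-- The cross product on Euclidean three-space. -/
def cross (a b : E3) : E3 := WithLp.toLp 2 (crossProduct a.ofLp b.ofLp)

/-- The unit normal `X_u × X_v / |X_u × X_v|`. -/
def gaussMap (X : ℂ → E3) (z : ℂ) : E3 :=
  ‖cross (fderiv ℝ X z 1) (fderiv ℝ X z Complex.I)‖⁻¹ •
    cross (fderiv ℝ X z 1) (fderiv ℝ X z Complex.I)

/-- The second fundamental form `A_{ij} = ⟨∂_i ∂_j X, n⟩`. -/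
def secondForm (X : ℂ → E3) : TensorField := fun z =>
  Matrix.of fun i j =>
    inner ℝ (fderiv ℝ (fun w => fderiv ℝ X w (coordVec j)) z (coordVec i)) (gaussMap X z)

/-- The mean curvature: the trace of the second fundamental form. -/
def meanCurvature (X : ℂ → E3) (z : ℂ) : ℝ := metricTrace (firstForm X) (secondForm X) z

/-- The Hopf differential `Q`: the quadratic differential with real part `A`. -/
def hopfDifferential (X : ℂ → E3) (z v w : ℂ) : ℂ :=
  quadraticDifferential (secondForm X) z v w

/-- Stereographic projection of the unit sphere to the Riemann sphere `ℂ ∪ {∞}`, the pole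
`(0, 0, 1)` going to `∞`. -/
def stereo (n : E3) : OnePoint ℂ :=
  if n 2 = 1 then OnePoint.infty
  else (((((n 0 : ℝ) : ℂ) + ((n 1 : ℝ) : ℂ) * Complex.I) / (1 - ((n 2 : ℝ) : ℂ)) : ℂ) : OnePoint ℂ)

/-! ### Minimal surfaces parametrized by a Riemann surface -/

/-- The holomorphic coordinate charts of a Riemann surface `M`. -/
abbrev holoCharts (M : Type*) [TopologicalSpace M] [ChartedSpace ℂ M] :
    Set (OpenPartialHomeomorph M ℂ) :=
  IsManifold.maximalAtlas 𝓘(ℂ) ω M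

/-- The local parametrization of the surface in a chart. -/
abbrev localParam {M : Type*} [TopologicalSpace M]
    (x : M → E3) (e : OpenPartialHomeomorph M ℂ) : ℂ → E3 := fun z => x (e.symm z)

/-- `x` is a smooth minimal immersion of the Riemann surface `M`, and the complex structure of
`M` is the one that `x` induces: multiplication by `i` is the rotation by a right angle for
the first fundamental form. The orientation is that of the complex structure. -/
structure IsMinimalImmersion {M : Type*} [TopologicalSpace M] [ChartedSpace ℂ M]
    (x : M → E3) : Prop where
  smooth : ∀ e ∈ holoCharts M, ContDiffOn ℝ ∞ (localParam x e) e.target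
  immersion : ∀ e ∈ holoCharts M, ∀ z ∈ e.target,
    Function.Injective (fderiv ℝ (localParam x e) z)
  conformal : ∀ e ∈ holoCharts M, ∀ z ∈ e.target, ∀ v : ℂ,
    ‖fderiv ℝ (localParam x e) z (Complex.I * v)‖ = ‖fderiv ℝ (localParam x e) z v‖ ∧
      inner ℝ (fderiv ℝ (localParam x e) z (Complex.I * v)) (fderiv ℝ (localParam x e) z v)
        = (0 : ℝ)
  minimal : ∀ e ∈ holoCharts M, ∀ z ∈ e.target, meanCurvature (localParam x e) z = 0

/-- `(G, η)` is the Weierstrass data of the minimal immersion `x`: `G` is the Gauss map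
followed by stereographic projection, and `η` is the complex linear one-form with
`Re η = x^* dx₃`. (That `G` is meromorphic and `η` holomorphic is then a consequence.) -/
structure IsWeierstrassData {M : Type*} [TopologicalSpace M] [ChartedSpace ℂ M]
    (x : M → E3) (G : M → OnePoint ℂ) (η : (p : M) → TangentSpace 𝓘(ℂ) p →L[ℂ] ℂ) : Prop where
  gauss : ∀ e ∈ holoCharts M, ∀ z ∈ e.target,
    G (e.symm z) = stereo (gaussMap (localParam x e) z)
  height : ∀ e ∈ holoCharts M, ∀ z ∈ e.target, ∀ v : ℂ,
    (fderiv ℝ (localParam x e) z v) 2 =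
      (η (e.symm z) (mfderiv 𝓘(ℂ) 𝓘(ℂ) e.symm z v)).re

/-- The coefficient `h` in `η = h dz`, where `z` is the coordinate of the chart. -/
def heightCoeff {M : Type*} [TopologicalSpace M] [ChartedSpace ℂ M]
    (η : (p : M) → TangentSpace 𝓘(ℂ) p →L[ℂ] ℂ) (e : OpenPartialHomeomorph M ℂ) (z : ℂ) : ℂ :=
  η (e.symm z) (mfderiv 𝓘(ℂ) 𝓘(ℂ) e.symm z (1 : ℂ))

/-- The finite values of a function to the Riemann sphere (with value `0` at the poles). -/
def finiteValue (q : OnePoint ℂ) : ℂ := q.elim 0 id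

/-- `G` as a function `G(z)` of the coordinate of the chart. -/
def localGauss {M : Type*} [TopologicalSpace M]
    (G : M → OnePoint ℂ) (e : OpenPartialHomeomorph M ℂ) (z : ℂ) : ℂ :=
  finiteValue (G (e.symm z))

/-! ### The expressions in the Weierstrass data -/

/-- The rational expression in `G, G', G'', G''', h, h', h''`. -/
def rhoExpr (G h : ℂ → ℂ) (z : ℂ) : ℂ :=
  iteratedDeriv 3 G z / deriv G z + iteratedDeriv 2 G z / (2 * G z)
    - 3 * deriv G z ^ 2 / (4 * G z ^ 2)
    - 7 * iteratedDeriv 2 G z ^ 2 / (4 * deriv G z ^ 2)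
    + iteratedDeriv 2 G z * deriv h z / (2 * deriv G z * h z)
    - deriv G z * deriv h z / (2 * G z * h z)
    - iteratedDeriv 2 h z / h z + 5 * deriv h z ^ 2 / (4 * h z ^ 2)

/-- The Schwarzian derivative `{G, z} = G'''/G' - (3/2) (G''/G')²`. -/
def schwarzian (G : ℂ → ℂ) (z : ℂ) : ℂ :=
  iteratedDeriv 3 G z / deriv G z - (3 / 2) * (iteratedDeriv 2 G z / deriv G z) ^ 2

end

end EntropyDiff

/-!
In a chart `z = u + i v`, a conformal minimal immersion is harmonic, so that
`φ = ∂_u X - i ∂_v X` is holomorphic and `φ_1² + φ_2² + φ_3² = 0`. Write `F = φ_1 - i φ_2` and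
`h = φ_3`. The linear algebra of a conformal frame gives `η = h dz`, `G = h / F` (with a pole
exactly where `F = 0`) and `g = |F|² (1 + |G|²)² |dz|² / 4`.

For conformal metrics `e^L |dz|²`, the curvature is `-Δ L / (2 e^L)` and the trace-free Hessian of
`f` is the real part of `2 (f_zz - L_z f_z) dz²`. Both are computed from Wirtinger derivatives
(`WirtingerJet`, `gaussCurvature_conformal`, `quadraticDifferential_traceFree_hessian`). For `g`
as above, the curvature is `-16 |G'|² / (|F|² (1 + |G|²)⁴)`, so that `K < 0` means `G' ≠ 0`. The
rescaled metric `ĝ = e^L |dz|²` and `f = log K_ĝ` satisfy, up to constants,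
`L = log (|G'|^{3/2} |F|^{1/2}) - log (1 + |G|²)` and
`f = log (|G'|^{1/2} |F|^{-1/2}) - log (1 + |G|²)`. In `f_zz - L_z f_z` every term that involves
`log (1 + |G|²)` cancels, and with `a = G''/G'`, `b = F'/F` one finds `P = (ρ / 2) dz²`,
`ρ = a' - b' - (3 a + b) (a - b) / 4` (`entropyDifferential_weierstrass`). Substituting
`F = h / G` yields the rational expression in `G` and `h` (`entropyCoeff_eq_rhoExpr`).

At a pole of `G`, the pair `(F, G)` is replaced by `(φ_1 + i φ_2, -1 / G)`, which describes the same
metric in the same form; hence `ρ` is holomorphic there, too, and the zeros and poles of `G` are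
simple, hence isolated. Finally `Q = -F G' dz²` (`hopfDifferential_eq`), so that `Q = dz²` gives
`b = -a` and `ρ / 2 = a' - a² / 2`, the Schwarzian derivative of `G`.
-/

namespace EntropyDiff

open Complex

/-! ### Second-order Wirtinger calculus -/

/-- On `V`, the real function `f` has differential `Re (Φ dz)`, and `Φ` has differential
`A dz + B dz̄`. Thus `Φ = 2 f_z`, `A = 2 f_zz`, and the reality of `B = 2 f_{z z̄}` expresses the
symmetry of the second derivative of `f`; the Laplacian of `f` is `2 B`. -/
structure WirtingerJet (V : Set ℂ) (f : ℂ → ℝ) (Φ A : ℂ → ℂ) (B : ℂ → ℝ) : Prop where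
  first : ∀ z ∈ V, HasFDerivAt f (reCLM ∘L (Φ z • (1 : ℂ →L[ℝ] ℂ))) z
  second : ∀ z ∈ V,
    HasFDerivAt Φ (A z • (1 : ℂ →L[ℝ] ℂ) + B z • (conjCLE : ℂ →L[ℝ] ℂ)) z

namespace WirtingerJet

variable {V : Set ℂ} {f f₁ f₂ : ℂ → ℝ} {Φ Φ₁ Φ₂ A A₁ A₂ : ℂ → ℂ} {B B₁ B₂ : ℂ → ℝ}

theorem congr (h : WirtingerJet V f Φ A B) (hV : IsOpen V) (hf : ∀ z ∈ V, f₁ z = f z) :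
    WirtingerJet V f₁ Φ A B where
  first z hz := (h.first z hz).congr_of_eventuallyEq
    (Filter.eventuallyEq_of_mem (hV.mem_nhds hz) hf)
  second := h.second

theorem const (V : Set ℂ) (c : ℝ) :
    WirtingerJet V (fun _ => c) (fun _ => 0) (fun _ => 0) (fun _ => 0) where
  first z _ := by
    refine HasFDerivAt.congr_fderiv (hasFDerivAt_const c z)
      (ContinuousLinearMap.ext fun v => ?_)
    simp
  second z _ := by
    refine HasFDerivAt.congr_fderiv (hasFDerivAt_const (0 : ℂ) z)
      (ContinuousLinearMap.ext fun v => ?_)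
    simp

theorem add (h₁ : WirtingerJet V f₁ Φ₁ A₁ B₁) (h₂ : WirtingerJet V f₂ Φ₂ A₂ B₂) :
    WirtingerJet V (fun z => f₁ z + f₂ z) (fun z => Φ₁ z + Φ₂ z) (fun z => A₁ z + A₂ z)
      (fun z => B₁ z + B₂ z) where
  first z hz := by
    refine HasFDerivAt.congr_fderiv ((h₁.first z hz).fun_add (h₂.first z hz))
      (ContinuousLinearMap.ext fun v => ?_)
    simp [add_mul]
  second z hz := by
    refine HasFDerivAt.congr_fderiv ((h₁.second z hz).fun_add (h₂.second z hz))
      (ContinuousLinearMap.ext fun v => ?_)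
    simp
    ring

theorem smul (c : ℝ) (h : WirtingerJet V f Φ A B) :
    WirtingerJet V (fun z => c * f z) (fun z => c * Φ z) (fun z => c * A z)
      (fun z => c * B z) where
  first z hz := by
    refine HasFDerivAt.congr_fderiv ((h.first z hz).const_mul c)
      (ContinuousLinearMap.ext fun v => ?_)
    simp [mul_assoc]
  second z hz := by
    refine HasFDerivAt.congr_fderiv ((h.second z hz).const_mul (c : ℂ))
      (ContinuousLinearMap.ext fun v => ?_)
    simp
    ring

/-- `f_u - i f_v = Φ`. -/
theorem pd_fst (h : WirtingerJet V f Φ A B) {z : ℂ} (hz : z ∈ V) (i : Fin 2) :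
    pd i f z = ![(Φ z).re, -(Φ z).im] i := by
  rw [pd, (h.first z hz).fderiv]
  fin_cases i <;> simp [coordVec]

theorem pd_re (h : WirtingerJet V f Φ A B) {z : ℂ} (hz : z ∈ V) (i : Fin 2) :
    pd i (fun w => (Φ w).re) z = ![(A z).re + B z, -(A z).im] i := by
  have h₁ := reCLM.hasFDerivAt.comp z (h.second z hz)
  have h₂ : fderiv ℝ (fun w => (Φ w).re) z = _ := h₁.fderiv
  rw [pd, h₂]
  fin_cases i <;> simp [coordVec]

theorem pd_im (h : WirtingerJet V f Φ A B) {z : ℂ} (hz : z ∈ V) (i : Fin 2) :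
    pd i (fun w => (Φ w).im) z = ![(A z).im, (A z).re - B z] i := by
  have h₁ := imCLM.hasFDerivAt.comp z (h.second z hz)
  have h₂ : fderiv ℝ (fun w => (Φ w).im) z = _ := h₁.fderiv
  rw [pd, h₂]
  fin_cases i <;> simp [coordVec, sub_eq_add_neg]

/-- The logarithm of the modulus of a nonvanishing holomorphic function is harmonic. -/
theorem log_norm {F : ℂ → ℂ} (hF : AnalyticOnNhd ℂ F V) (h0 : ∀ z ∈ V, F z ≠ 0) :
    WirtingerJet V (fun z => Real.log ‖F z‖) (logDeriv F) (deriv (logDeriv F))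
      (fun _ => 0) where
  first z hz := by
    have h₁ := (hF z hz).differentiableAt.hasDerivAt.complexToReal_fderiv
    have h₂ := (h₁.norm_sq.log (by simpa using h0 z hz)).const_mul (1 / 2 : ℝ)
    have h₃ : (fun w => Real.log ‖F w‖) = fun w => 1 / 2 * Real.log (‖F w‖ ^ 2) := by
      ext w
      rw [Real.log_pow]
      push_cast
      ring
    rw [h₃]
    refine HasFDerivAt.congr_fderiv (h₂)
      (ContinuousLinearMap.ext fun v => ?_)
    have hn : (F z).re * (F z).re + (F z).im * (F z).im ≠ 0 := by
      rw [← normSq_apply]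
      exact (normSq_pos.2 (h0 z hz)).ne'
    simp [logDeriv_apply, ← normSq_eq_norm_sq, normSq_apply, div_re, div_im, Complex.inner]
    field_simp
    ring
  second z hz := by
    have h₁ : AnalyticAt ℂ (logDeriv F) z := (hF z hz).deriv.div (hF z hz) (h0 z hz)
    refine h₁.differentiableAt.hasDerivAt.complexToReal_fderiv.congr_fderiv ?_
    simp

/-- The potential `log (1 + |G|²)` of the spherical metric pulled back by a holomorphic `G`. -/
theorem log_one_add_normSq {G : ℂ → ℂ} (hG : AnalyticOnNhd ℂ G V) :
    WirtingerJet V (fun z => Real.log (1 + ‖G z‖ ^ 2))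
      (fun z => 2 * (starRingEnd ℂ (G z) * deriv G z * (1 + G z * starRingEnd ℂ (G z))⁻¹))
      (fun z => 2 * (starRingEnd ℂ (G z) * deriv (deriv G) z *
          (1 + G z * starRingEnd ℂ (G z))⁻¹ -
        (starRingEnd ℂ (G z) * deriv G z * (1 + G z * starRingEnd ℂ (G z))⁻¹) ^ 2))
      (fun z => 2 * ‖deriv G z‖ ^ 2 / (1 + ‖G z‖ ^ 2) ^ 2) where
  first z hz := by
    have h₁ := (hG z hz).differentiableAt.hasDerivAt.complexToReal_fderiv
    have hp : (1 + ‖G z‖ ^ 2 : ℝ) ≠ 0 := by positivity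
    have h₂ := (h₁.norm_sq.const_add 1).log hp
    refine HasFDerivAt.congr_fderiv (h₂)
      (ContinuousLinearMap.ext fun v => ?_)
    have hw : 1 + G z * starRingEnd ℂ (G z) = ((1 + ‖G z‖ ^ 2 : ℝ) : ℂ) := by
      rw [mul_conj, normSq_eq_norm_sq]
      push_cast
      rfl
    rw [hw, ← ofReal_inv]
    simp [Complex.inner, -ofReal_add, -ofReal_inv]
    field_simp
    ring
  second z hz := by
    have h₁ := (hG z hz).differentiableAt.hasDerivAt.complexToReal_fderiv
    have h₂ := (hG z hz).deriv.differentiableAt.hasDerivAt.complexToReal_fderiv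
    have h₃ : HasFDerivAt (fun w => starRingEnd ℂ (G w)) _ z :=
      (conjCLE : ℂ →L[ℝ] ℂ).hasFDerivAt.comp z h₁
    have hw : 1 + G z * starRingEnd ℂ (G z) = ((1 + ‖G z‖ ^ 2 : ℝ) : ℂ) := by
      rw [mul_conj, normSq_eq_norm_sq]
      push_cast
      rfl
    have hp : (1 + ‖G z‖ ^ 2 : ℝ) ≠ 0 := by positivity
    have hw0 : 1 + G z * starRingEnd ℂ (G z) ≠ 0 := by
      rw [hw]
      exact_mod_cast hp
    have h₄ : HasFDerivAt (fun w => (1 + G w * starRingEnd ℂ (G w))⁻¹) _ z :=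
      (hasDerivAt_inv hw0).complexToReal_fderiv.comp z ((h₁.fun_mul h₃).const_add 1)
    refine HasFDerivAt.congr_fderiv (((h₃.fun_mul h₂).fun_mul h₄).const_mul 2)
      (ContinuousLinearMap.ext fun v => ?_)
    have hB : ((2 * ‖deriv G z‖ ^ 2 / (1 + ‖G z‖ ^ 2) ^ 2 : ℝ) : ℂ)
        = 2 * (deriv G z * starRingEnd ℂ (deriv G z)) /
          (1 + G z * starRingEnd ℂ (G z)) ^ 2 := by
      rw [hw, mul_conj, normSq_eq_norm_sq]
      push_cast
      rfl
    simp [-ofReal_div, -ofReal_mul, hB]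
    field_simp
    ring

end WirtingerJet

/-! ### Conformal metrics -/

section Conformal

variable {V : Set ℂ} {g : TensorField} {L f : ℂ → ℝ} {Φ A Ψ C : ℂ → ℂ} {B D : ℂ → ℝ}

theorem pd_congr {V : Set ℂ} (hV : IsOpen V) {f₁ f₂ : ℂ → ℝ} (h : ∀ z ∈ V, f₁ z = f₂ z)
    {z : ℂ} (hz : z ∈ V) (i : Fin 2) : pd i f₁ z = pd i f₂ z := by
  rw [pd, pd, (Filter.eventuallyEq_of_mem (hV.mem_nhds hz) h).fderiv_eq]

theorem inv_conformal (hg : ∀ z ∈ V, g z = Real.exp (L z) • (1 : Matrix (Fin 2) (Fin 2) ℝ))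
    {z : ℂ} (hz : z ∈ V) : (g z)⁻¹ = (Real.exp (L z))⁻¹ • (1 : Matrix (Fin 2) (Fin 2) ℝ) := by
  refine Matrix.inv_eq_right_inv ?_
  rw [hg z hz]
  simp [smul_smul, Real.exp_ne_zero]

theorem christoffel_conformal (hV : IsOpen V) (hL : WirtingerJet V L Φ A B)
    (hg : ∀ z ∈ V, g z = Real.exp (L z) • (1 : Matrix (Fin 2) (Fin 2) ℝ)) {z : ℂ} (hz : z ∈ V)
    (k i j : Fin 2) :
    christoffel g k i j z = 1 / 2 * ((1 : Matrix (Fin 2) (Fin 2) ℝ) j k * pd i L z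
      + (1 : Matrix (Fin 2) (Fin 2) ℝ) i k * pd j L z
      - (1 : Matrix (Fin 2) (Fin 2) ℝ) i j * pd k L z) := by
  have hpd : ∀ m a b : Fin 2, pd m (fun w => g w a b) z
      = Real.exp (L z) * ((1 : Matrix (Fin 2) (Fin 2) ℝ) a b * pd m L z) := by
    intro m a b
    rw [pd_congr hV (f₂ := fun w => Real.exp (L w) * (1 : Matrix (Fin 2) (Fin 2) ℝ) a b)
      (fun w hw => by simp [hg w hw]) hz, pd, ((hL.first z hz).exp.mul_const _).fderiv, pd,
      (hL.first z hz).fderiv]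
    simp
    ring
  simp only [christoffel, hpd, inv_conformal hg hz, Matrix.smul_apply, smul_eq_mul]
  have he := Real.exp_ne_zero (L z)
  rw [Finset.sum_eq_single k]
  · simp
    field_simp
  · intro l _ hl
    simp [Matrix.one_apply_ne (Ne.symm hl)]
  · simp

/-- Liouville's equation: the curvature of `e^L |dz|²` is `-(Δ L) / (2 e^L)`. -/
theorem gaussCurvature_conformal (hV : IsOpen V) (hL : WirtingerJet V L Φ A B)
    (hg : ∀ z ∈ V, g z = Real.exp (L z) • (1 : Matrix (Fin 2) (Fin 2) ℝ)) {z : ℂ} (hz : z ∈ V) :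
    gaussCurvature g z = -B z / Real.exp (L z) := by
  have h₁ : pd 0 (christoffel g 0 1 1) z = -(1 / 2) * ((A z).re + B z) := by
    have hd := (reCLM.hasFDerivAt.comp z (hL.second z hz)).differentiableAt
    rw [pd_congr hV (f₂ := fun w => -(1 / 2) * (Φ w).re) (fun w hw => by
      rw [christoffel_conformal hV hL hg hw, hL.pd_fst hw, hL.pd_fst hw]; simp) hz, pd,
      fderiv_const_mul (by exact hd)]
    have := hL.pd_re hz 0
    simp only [pd] at this
    simp [this]
  have h₂ : pd 1 (christoffel g 0 0 1) z = -(1 / 2) * ((A z).re - B z) := by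
    have hd := (imCLM.hasFDerivAt.comp z (hL.second z hz)).differentiableAt
    rw [pd_congr hV (f₂ := fun w => -(1 / 2) * (Φ w).im) (fun w hw => by
      rw [christoffel_conformal hV hL hg hw, hL.pd_fst hw, hL.pd_fst hw]; simp) hz, pd,
      fderiv_const_mul (by exact hd)]
    have := hL.pd_im hz 1
    simp only [pd] at this
    simp [this]
  have he := Real.exp_ne_zero (L z)
  have h₃ : curvatureComp g 0 z = -B z := by
    rw [curvatureComp, h₁, h₂]
    simp only [Fin.sum_univ_two, christoffel_conformal hV hL hg hz, hL.pd_fst hz]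
    simp
    ring
  rw [gaussCurvature, Fin.sum_univ_two, h₃, hg z hz]
  simp
  field_simp

/-- For the metric `e^L |dz|²`, the quadratic differential of the trace-free Hessian of `f` is
`2 (f_zz - L_z f_z) dz²`. -/
theorem quadraticDifferential_traceFree_hessian (hV : IsOpen V) (hL : WirtingerJet V L Φ A B)
    (hg : ∀ z ∈ V, g z = Real.exp (L z) • (1 : Matrix (Fin 2) (Fin 2) ℝ))
    (hf : WirtingerJet V f Ψ C D) {z : ℂ} (hz : z ∈ V) (v w : ℂ) :
    quadraticDifferential (traceFree g (hessian g f)) z v w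
      = (C z - 1 / 2 * Φ z * Ψ z) * (v * w) := by
  have h0 : ∀ i, pd i (pd 0 f) z = ![(C z).re + D z, -(C z).im] i := fun i => by
    rw [pd_congr hV (f₂ := fun w => (Ψ w).re) (fun w hw => by simp [hf.pd_fst hw]) hz,
      hf.pd_re hz]
  have h1 : ∀ i, pd i (pd 1 f) z = -![(C z).im, (C z).re - D z] i := fun i => by
    rw [pd_congr hV (f₂ := fun w => -(Ψ w).im) (fun w hw => by simp [hf.pd_fst hw]) hz,
      ← hf.pd_im hz, pd, pd, fderiv_fun_neg]
    simp
  have he := Real.exp_ne_zero (L z)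
  have htr : ∀ S : TensorField, traceFree g S z = S z - ((S z 0 0 + S z 1 1) / 2) • 1 := by
    intro S
    rw [traceFree, metricTrace, inv_conformal hg hz, hg z hz, smul_smul]
    congr 2
    simp [Fin.sum_univ_two]
    field_simp
  have h00 : hessian g f z 0 0 = (C z).re + D z
      - 1 / 2 * ((Φ z).re * (Ψ z).re - (Φ z).im * (Ψ z).im) := by
    simp [hessian, christoffel_conformal hV hL hg hz, h0, hL.pd_fst hz, hf.pd_fst hz,
      Fin.sum_univ_two]
    ring
  have h11 : hessian g f z 1 1 = -(C z).re + D z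
      + 1 / 2 * ((Φ z).re * (Ψ z).re - (Φ z).im * (Ψ z).im) := by
    simp [hessian, christoffel_conformal hV hL hg hz, h1, hL.pd_fst hz, hf.pd_fst hz,
      Fin.sum_univ_two]
    ring
  have h01 : hessian g f z 0 1 = -(C z).im
      + 1 / 2 * ((Φ z).re * (Ψ z).im + (Φ z).im * (Ψ z).re) := by
    simp [hessian, christoffel_conformal hV hL hg hz, h1, hL.pd_fst hz, hf.pd_fst hz,
      Fin.sum_univ_two]
    ring
  have h10 : hessian g f z 1 0 = -(C z).im
      + 1 / 2 * ((Φ z).re * (Ψ z).im + (Φ z).im * (Ψ z).re) := by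
    simp [hessian, christoffel_conformal hV hL hg hz, h0, hL.pd_fst hz, hf.pd_fst hz,
      Fin.sum_univ_two]
    ring
  apply Complex.ext <;>
  · simp [quadraticDifferential, toForm, htr, h00, h01, h10, h11, coord, Fin.sum_univ_two]
    ring

end Conformal

/-! ### The entropy differential of a metric in Weierstrass form -/

/-- The coefficient `a' - b' - (3 a + b) (a - b) / 4`, with `a = G''/G'` and `b = F'/F`, of twice
the entropy differential of the metric `|F|² (1 + |G|²)² |dz|² / 4`. -/
noncomputable def entropyCoeff (F G : ℂ → ℂ) (z : ℂ) : ℂ :=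
  deriv (logDeriv (deriv G)) z - deriv (logDeriv F) z
    - 1 / 4 * (3 * logDeriv (deriv G) z + logDeriv F z) *
      (logDeriv (deriv G) z - logDeriv F z)

section Weierstrass

variable {V : Set ℂ} {F G : ℂ → ℂ} {g : TensorField}

/-- The metric `|F|² (1 + |G|²)² |dz|² / 4` has curvature
`-16 |G'|² / (|F|² (1 + |G|²)⁴)`. -/
theorem gaussCurvature_weierstrass (hV : IsOpen V) (hF : AnalyticOnNhd ℂ F V)
    (hG : AnalyticOnNhd ℂ G V) (hF0 : ∀ z ∈ V, F z ≠ 0)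
    (hg : ∀ z ∈ V, g z = (1 / 4 * ‖F z‖ ^ 2 * (1 + ‖G z‖ ^ 2) ^ 2) •
      (1 : Matrix (Fin 2) (Fin 2) ℝ)) {z : ℂ} (hz : z ∈ V) :
    gaussCurvature g z = -(16 * ‖deriv G z‖ ^ 2) / (‖F z‖ ^ 2 * (1 + ‖G z‖ ^ 2) ^ 4) := by
  have hL := ((WirtingerJet.const V (Real.log (1 / 4))).add
    ((WirtingerJet.log_norm hF hF0).smul 2)).add
    ((WirtingerJet.log_one_add_normSq hG).smul 2)
  have hexp : ∀ w ∈ V, Real.exp (Real.log (1 / 4) + 2 * Real.log ‖F w‖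
      + 2 * Real.log (1 + ‖G w‖ ^ 2)) = 1 / 4 * ‖F w‖ ^ 2 * (1 + ‖G w‖ ^ 2) ^ 2 := by
    intro w hw
    have h₁ : 0 < ‖F w‖ := norm_pos_iff.2 (hF0 w hw)
    have h₂ : 0 < 1 + ‖G w‖ ^ 2 := by positivity
    rw [Real.exp_add, Real.exp_add, Real.exp_log (by norm_num), two_mul, two_mul, Real.exp_add,
      Real.exp_add, Real.exp_log h₁, Real.exp_log h₂]
    ring
  rw [gaussCurvature_conformal hV hL (fun w hw => by rw [hg w hw, hexp w hw]) hz, hexp z hz]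
  have h₁ : ‖F z‖ ≠ 0 := norm_ne_zero_iff.2 (hF0 z hz)
  have h₂ : 1 + ‖G z‖ ^ 2 ≠ 0 := by positivity
  field_simp
  ring

/-- The rescaled metric `e^L |dz|²` has `e^L = 2 |G'|^{3/2} |F|^{1/2} / (1 + |G|²)` and curvature
`e^f = 2 |G'|² / ((1 + |G|²)² e^L)`. In `2 (f_zz - L_z f_z)`, all terms with the spherical
potential `log (1 + |G|²)` cancel, and what is left is holomorphic. -/
theorem entropyDifferential_weierstrass (hV : IsOpen V) (hF : AnalyticOnNhd ℂ F V)
    (hG : AnalyticOnNhd ℂ G V) (hF0 : ∀ z ∈ V, F z ≠ 0) (hG0 : ∀ z ∈ V, deriv G z ≠ 0)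
    (hg : ∀ z ∈ V, g z = (1 / 4 * ‖F z‖ ^ 2 * (1 + ‖G z‖ ^ 2) ^ 2) •
      (1 : Matrix (Fin 2) (Fin 2) ℝ)) {z : ℂ} (hz : z ∈ V) (v w : ℂ) :
    entropyDifferential g z v w = entropyCoeff F G z / 2 * (v * w) := by
  have jF := WirtingerJet.log_norm hF hF0
  have jG := WirtingerJet.log_norm (fun z hz => (hG z hz).deriv) hG0
  have jS := WirtingerJet.log_one_add_normSq hG
  have jL := (((WirtingerJet.const V (Real.log 2)).add (jG.smul (3 / 2))).add
    (jF.smul (1 / 2))).add (jS.smul (-1))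
  have hpF : ∀ w ∈ V, 0 < ‖F w‖ := fun w hw => norm_pos_iff.2 (hF0 w hw)
  have hpG : ∀ w ∈ V, 0 < ‖deriv G w‖ := fun w hw => norm_pos_iff.2 (hG0 w hw)
  have hpS : ∀ w, 0 < 1 + ‖G w‖ ^ 2 := fun w => by positivity
  have hres : ∀ w ∈ V, rescaledMetric g w = Real.exp (Real.log 2 + 3 / 2 * Real.log ‖deriv G w‖
      + 1 / 2 * Real.log ‖F w‖ + -1 * Real.log (1 + ‖G w‖ ^ 2)) •
      (1 : Matrix (Fin 2) (Fin 2) ℝ) := by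
    intro w hw
    have h₁ := hpF w hw
    have h₂ := hpG w hw
    have h₃ := hpS w
    have hm : 0 < 1 / 4 * ‖F w‖ ^ 2 * (1 + ‖G w‖ ^ 2) ^ 2 := by positivity
    have hk : 0 < 16 * ‖deriv G w‖ ^ 2 / (‖F w‖ ^ 2 * (1 + ‖G w‖ ^ 2) ^ 4) := by positivity
    rw [rescaledMetric, gaussCurvature_weierstrass hV hF hG hF0 hg hw, hg w hw, smul_smul, neg_div,
      neg_neg, Real.rpow_def_of_pos hk]
    rw [← Real.exp_log hm, ← Real.exp_add]
    have h16 : Real.log 16 = 4 * Real.log 2 := by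
      rw [show (16 : ℝ) = 2 ^ 4 by norm_num, Real.log_pow]
      norm_num
    have h4 : Real.log (1 / 4) = -(2 * Real.log 2) := by
      rw [one_div, Real.log_inv, show (4 : ℝ) = 2 ^ 2 by norm_num, Real.log_pow]
      norm_num
    congr 2
    rw [Real.log_div (by positivity) (by positivity), Real.log_mul (by positivity) (by positivity),
      Real.log_mul (by positivity) (by positivity), Real.log_mul (by positivity) (by positivity),
      Real.log_mul (by positivity) (by positivity), Real.log_pow, Real.log_pow, Real.log_pow,
      Real.log_pow, h16, h4]
    push_cast
    ring
  have jf := (((WirtingerJet.const V (Real.log 2)).add (jG.smul 2)).add (jS.smul (-2))).add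
    (jL.smul (-1))
  have jK := jf.congr hV (f₁ := fun w => Real.log (gaussCurvature (rescaledMetric g) w)) <| by
    intro w hw
    have h₂ := hpG w hw
    have h₃ := hpS w
    rw [gaussCurvature_conformal hV jL hres hw, Real.log_div (by
      have : 0 < 2 * ‖deriv G w‖ ^ 2 / (1 + ‖G w‖ ^ 2) ^ 2 := by positivity
      linarith) (Real.exp_ne_zero _), Real.log_exp]
    have hB : -(0 + 3 / 2 * 0 + 1 / 2 * 0 + -1 * (2 * ‖deriv G w‖ ^ 2 / (1 + ‖G w‖ ^ 2) ^ 2))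
        = 2 * ‖deriv G w‖ ^ 2 / (1 + ‖G w‖ ^ 2) ^ 2 := by ring
    rw [hB, Real.log_div (by positivity) (by positivity),
      Real.log_mul (by positivity) (by positivity), Real.log_pow, Real.log_pow]
    push_cast
    ring
  rw [entropyDifferential, entropyForm, conservedForm,
    quadraticDifferential_traceFree_hessian hV jL hres jK hz]
  -- `s_zz = (G''/G') s_z - s_z²` for `s = log (1 + |G|²)`
  have ha : starRingEnd ℂ (G z) * deriv (deriv G) z * (1 + G z * starRingEnd ℂ (G z))⁻¹
      = logDeriv (deriv G) z *
        (starRingEnd ℂ (G z) * deriv G z * (1 + G z * starRingEnd ℂ (G z))⁻¹) := by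
    rw [logDeriv_apply]
    have := hG0 z hz
    field_simp
  rw [ha, entropyCoeff]
  push_cast
  ring

end Weierstrass

/-! ### Conformal frames in Euclidean space -/

section Frame

theorem inner_E3 (a b : E3) : inner ℝ a b = a 0 * b 0 + a 1 * b 1 + a 2 * b 2 := by
  simp [PiLp.inner_apply, Fin.sum_univ_three, mul_comm]

theorem cross_zero (a b : E3) : cross a b 0 = a 1 * b 2 - a 2 * b 1 := by
  simp [cross, cross_apply]

theorem cross_one (a b : E3) : cross a b 1 = a 2 * b 0 - a 0 * b 2 := by
  simp [cross, cross_apply]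

theorem cross_two (a b : E3) : cross a b 2 = a 0 * b 1 - a 1 * b 0 := by
  simp [cross, cross_apply]

/-- The scalar triple product squared is the Gram determinant; it is `E² |W|²` here. -/
theorem eq_zero_of_orthogonal_conformal_frame {W p q : E3} {E : ℝ} (hE : 0 < E)
    (hp : inner ℝ p p = E) (hq : inner ℝ q q = E) (hpq : inner ℝ p q = (0 : ℝ))
    (h₁ : inner ℝ W p = (0 : ℝ)) (h₂ : inner ℝ W q = (0 : ℝ))
    (h₃ : inner ℝ W (cross p q) = (0 : ℝ)) : W = 0 := by
  have gram : (inner ℝ W (cross p q) : ℝ) ^ 2 =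
      inner ℝ W W * (inner ℝ p p * inner ℝ q q - (inner ℝ p q : ℝ) ^ 2)
      - inner ℝ W p * (inner ℝ W p * inner ℝ q q - inner ℝ p q * inner ℝ W q)
      + inner ℝ W q * (inner ℝ W p * inner ℝ p q - inner ℝ p p * inner ℝ W q) := by
    simp only [inner_E3, cross_zero, cross_one, cross_two]
    ring
  rw [h₁, h₂, h₃, hp, hq, hpq] at gram
  have : (inner ℝ W W : ℝ) * E ^ 2 = 0 := by linear_combination -gram
  rcases mul_eq_zero.1 this with h | h
  · exact inner_self_eq_zero.1 h
  · exact absurd h (by positivity)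

theorem norm_cross_of_conformal {p q : E3} {E : ℝ} (hE : 0 < E)
    (hp : inner ℝ p p = E) (hq : inner ℝ q q = E) (hpq : inner ℝ p q = (0 : ℝ)) :
    ‖cross p q‖ = E := by
  have h : ‖cross p q‖ ^ 2 = E ^ 2 := by
    have gram : (inner ℝ (cross p q) (cross p q) : ℝ) =
        inner ℝ p p * inner ℝ q q - (inner ℝ p q : ℝ) ^ 2 := by
      simp only [inner_E3, cross_zero, cross_one, cross_two]
      ring
    rw [← real_inner_self_eq_norm_sq, gram, hp, hq, hpq]
    ring
  exact (sq_eq_sq₀ (norm_nonneg _) hE.le).1 h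

/-- The matrix with columns `p`, `q` and `(p × q) / √E` is `√E` times an orthogonal matrix, so its
third row has length `√E`, too. -/
theorem cross_two_sq_of_conformal {p q : E3} {E : ℝ}
    (hp : inner ℝ p p = E) (hq : inner ℝ q q = E) (hpq : inner ℝ p q = (0 : ℝ)) :
    cross p q 2 ^ 2 = E * (E - p 2 ^ 2 - q 2 ^ 2) := by
  rw [inner_E3] at hp hq hpq
  rw [cross_two]
  have l₁ : p 0 ^ 2 + p 1 ^ 2 = E - p 2 ^ 2 := by linear_combination hp
  have l₂ : q 0 ^ 2 + q 1 ^ 2 = E - q 2 ^ 2 := by linear_combination hq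
  have l₃ : p 0 * q 0 + p 1 * q 1 = -(p 2 * q 2) := by linear_combination hpq
  linear_combination (q 0 ^ 2 + q 1 ^ 2) * l₁ + (E - p 2 ^ 2) * l₂
    - (p 0 * q 0 + p 1 * q 1 - p 2 * q 2) * l₃

end Frame

/-! ### The Weierstrass representation in a coordinate domain -/

/-- `X` is a conformally parametrized minimal immersion of the open set `U`. -/
structure IsConformalMinimal (X : ℂ → E3) (U : Set ℂ) : Prop where
  isOpen : IsOpen U
  smooth : ContDiffOn ℝ ∞ X U
  immersion : ∀ z ∈ U, Function.Injective (fderiv ℝ X z)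
  conformal : ∀ z ∈ U, ∀ v : ℂ, ‖fderiv ℝ X z (I * v)‖ = ‖fderiv ℝ X z v‖ ∧
    inner ℝ (fderiv ℝ X z (I * v)) (fderiv ℝ X z v) = (0 : ℝ)
  minimal : ∀ z ∈ U, meanCurvature X z = 0

/-- The `k`-th component `φ_k = ∂_u X_k - i ∂_v X_k = 2 ∂X_k/∂z` of the isotropic curve. -/
noncomputable def isotropic (X : ℂ → E3) (k : Fin 3) (z : ℂ) : ℂ :=
  (fderiv ℝ X z 1 k : ℂ) - I * (fderiv ℝ X z I k : ℂ)

/-- `φ_1 - i φ_2`, the coefficient of the one-form `η / G`. It vanishes at the poles of `G`. -/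
noncomputable def spinorSq (X : ℂ → E3) (z : ℂ) : ℂ := isotropic X 0 z - I * isotropic X 1 z

/-- `φ_1 + i φ_2`, the coefficient of the one-form `-G η`. It vanishes at the zeros of `G`. -/
noncomputable def spinorSq' (X : ℂ → E3) (z : ℂ) : ℂ := isotropic X 0 z + I * isotropic X 1 z

/-- The conformal factor `|X_u|²`. -/
noncomputable def conformalFactor (X : ℂ → E3) (z : ℂ) : ℝ :=
  inner ℝ (fderiv ℝ X z 1) (fderiv ℝ X z 1)

/-- Half of `|φ|²`, rewritten by means of the isotropy relation `F F' = -H²` in terms of `F` and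
`G = H / F` only. -/
theorem weierstrass_conformalFactor {F F' H : ℂ} (h0 : F ≠ 0) (h : F * F' = -H ^ 2) :
    1 / 4 * (‖F‖ ^ 2 + ‖F'‖ ^ 2 + 2 * ‖H‖ ^ 2)
      = 1 / 4 * ‖F‖ ^ 2 * (1 + ‖H / F‖ ^ 2) ^ 2 := by
  have hn : ‖F‖ * ‖F'‖ = ‖H‖ ^ 2 := by rw [← norm_mul, h, norm_neg, norm_pow]
  have hF : ‖F‖ ≠ 0 := norm_ne_zero_iff.2 h0
  have hF' : ‖F'‖ = ‖H‖ ^ 2 / ‖F‖ := by rw [← hn]; field_simp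
  rw [norm_div, hF']
  field_simp
  ring

namespace IsConformalMinimal

variable {X : ℂ → E3} {U : Set ℂ} {z : ℂ}

theorem conformalFactor_pos (h : IsConformalMinimal X U) (hz : z ∈ U) :
    0 < conformalFactor X z := by
  refine real_inner_self_pos.2 fun h0 => ?_
  have := h.immersion z hz (h0.trans (map_zero _).symm)
  exact one_ne_zero this

theorem inner_dv_dv (h : IsConformalMinimal X U) (hz : z ∈ U) :
    inner ℝ (fderiv ℝ X z I) (fderiv ℝ X z I) = conformalFactor X z := by
  have := (h.conformal z hz 1).1
  rw [mul_one] at this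
  rw [conformalFactor, real_inner_self_eq_norm_sq, real_inner_self_eq_norm_sq, this]

theorem inner_du_dv (h : IsConformalMinimal X U) (hz : z ∈ U) :
    inner ℝ (fderiv ℝ X z 1) (fderiv ℝ X z I) = (0 : ℝ) := by
  have := (h.conformal z hz 1).2
  rwa [mul_one, real_inner_comm] at this

theorem firstForm_eq (h : IsConformalMinimal X U) (hz : z ∈ U) :
    firstForm X z = conformalFactor X z • (1 : Matrix (Fin 2) (Fin 2) ℝ) := by
  have h₁ := h.inner_du_dv hz
  have h₂ := h.inner_dv_dv hz
  ext i j
  fin_cases i <;> fin_cases j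
  · simp [firstForm, coordVec, conformalFactor]
  · simpa [firstForm, coordVec] using h₁
  · simpa [firstForm, coordVec, real_inner_comm] using h₁
  · simpa [firstForm, coordVec] using h₂

theorem gaussMap_eq (h : IsConformalMinimal X U) (hz : z ∈ U) :
    gaussMap X z = (conformalFactor X z)⁻¹ • cross (fderiv ℝ X z 1) (fderiv ℝ X z I) := by
  rw [gaussMap, norm_cross_of_conformal (h.conformalFactor_pos hz) rfl (h.inner_dv_dv hz)
    (h.inner_du_dv hz)]

theorem hasFDerivAt_fderiv (h : IsConformalMinimal X U) (hz : z ∈ U) (v : ℂ) :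
    HasFDerivAt (fun w => fderiv ℝ X w v) ((fderiv ℝ (fderiv ℝ X) z).flip v) z := by
  have h₁ : ContDiffAt ℝ ∞ X z := h.smooth.contDiffAt (h.isOpen.mem_nhds hz)
  have h₂ : DifferentiableAt ℝ (fderiv ℝ X) z :=
    (h₁.fderiv_right (m := 1) (by norm_cast)).differentiableAt (by norm_num)
  exact (h₂.hasFDerivAt.clm_apply (hasFDerivAt_const v z)).congr_fderiv (by ext; simp)

theorem fderiv_fderiv_symm (h : IsConformalMinimal X U) (hz : z ∈ U) (v w : ℂ) :
    fderiv ℝ (fderiv ℝ X) z v w = fderiv ℝ (fderiv ℝ X) z w v := by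
  have h₁ : ContDiffAt ℝ ∞ X z := h.smooth.contDiffAt (h.isOpen.mem_nhds hz)
  exact h₁.isSymmSndFDerivAt (by
    rw [minSmoothness_of_isRCLikeNormedField]
    exact WithTop.coe_le_coe.2 (le_top : (2 : ℕ∞) ≤ ⊤)) v w

/-- A conformal minimal immersion is harmonic: differentiating the conformality relations shows
that `Δ X` is normal, and minimality says that its normal component vanishes. -/
theorem laplacian_eq_zero (h : IsConformalMinimal X U) (hz : z ∈ U) :
    fderiv ℝ (fderiv ℝ X) z 1 1 + fderiv ℝ (fderiv ℝ X) z I I = 0 := by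
  set D := fderiv ℝ (fderiv ℝ X) z with hD
  have hu := h.hasFDerivAt_fderiv hz 1
  have hv := h.hasFDerivAt_fderiv hz I
  have hnhds := h.isOpen.mem_nhds hz
  have hsymm : D I 1 = D 1 I := h.fderiv_fderiv_symm hz I 1
  -- the derivatives of `|X_u|² = |X_v|²` and of `⟨X_u, X_v⟩ = 0` in the direction `t`
  have e₁ : ∀ t : ℂ, (inner ℝ (fderiv ℝ X z 1) (D t 1) : ℝ)
      = inner ℝ (fderiv ℝ X z I) (D t I) := by
    intro t
    have heq : (fun w => inner ℝ (fderiv ℝ X w I) (fderiv ℝ X w I)) =ᶠ[𝓝 z]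
        fun w => (inner ℝ (fderiv ℝ X w 1) (fderiv ℝ X w 1) : ℝ) :=
      Filter.eventuallyEq_of_mem hnhds fun w hw => h.inner_dv_dv hw
    have := congrArg (fun T : ℂ →L[ℝ] ℝ => T t)
      (((hu.inner ℝ hu).congr_of_eventuallyEq heq).unique (hv.inner ℝ hv))
    simp [real_inner_comm, ← hD] at this
    linarith
  have e₂ : ∀ t : ℂ, (inner ℝ (D t 1) (fderiv ℝ X z I) : ℝ) +
      inner ℝ (fderiv ℝ X z 1) (D t I) = 0 := by
    intro t
    have heq : (fun w => (inner ℝ (fderiv ℝ X w 1) (fderiv ℝ X w I) : ℝ)) =ᶠ[𝓝 z]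
        fun _ => 0 := Filter.eventuallyEq_of_mem hnhds fun w hw => h.inner_du_dv hw
    have := congrArg (fun T : ℂ →L[ℝ] ℝ => T t)
      ((hu.inner ℝ hv).unique ((hasFDerivAt_const (0 : ℝ) z).congr_of_eventuallyEq heq))
    simp [← hD] at this
    linarith
  have hE := h.conformalFactor_pos hz
  refine eq_zero_of_orthogonal_conformal_frame hE rfl (h.inner_dv_dv hz) (h.inner_du_dv hz)
    ?_ ?_ ?_
  · have a := e₁ 1
    have b := e₂ I
    rw [hsymm] at b
    rw [inner_add_left, real_inner_comm, real_inner_comm _ (D I I)]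
    rw [real_inner_comm] at b
    linarith
  · have a := e₁ I
    have b := e₂ 1
    rw [hsymm] at a
    rw [inner_add_left, real_inner_comm _ (D I I)]
    linarith
  · have hm := h.minimal z hz
    have hinv := inv_conformal (V := {z}) (g := firstForm X)
      (L := fun w => Real.log (conformalFactor X w)) (fun w hw => by
        rw [Set.mem_singleton_iff.1 hw, Real.exp_log hE, h.firstForm_eq hz]) rfl
    rw [meanCurvature, metricTrace, hinv, Real.exp_log hE] at hm
    have e₃ : ∀ a b : ℂ, fderiv ℝ (fun w => fderiv ℝ X w b) z a = D a b := fun a b => by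
      rw [(h.hasFDerivAt_fderiv hz b).fderiv]
      rfl
    simp [Fin.sum_univ_two, secondForm, coordVec, e₃, h.gaussMap_eq hz, inner_smul_right] at hm
    rw [inner_add_left]
    field_simp at hm
    rwa [mul_zero] at hm

theorem hasDerivAt_isotropic (h : IsConformalMinimal X U) (hz : z ∈ U) (k : Fin 3) :
    HasDerivAt (isotropic X k) ((fderiv ℝ (fderiv ℝ X) z 1 1 k : ℂ)
      - I * (fderiv ℝ (fderiv ℝ X) z 1 I k : ℂ)) z := by
  set D := fderiv ℝ (fderiv ℝ X) z with hD
  have hc : ∀ v : ℂ, HasFDerivAt (fun w => ((fderiv ℝ X w v k : ℝ) : ℂ)) _ z := fun v =>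
    (ofRealCLM ∘L (EuclideanSpace.proj k : E3 →L[ℝ] ℝ)).hasFDerivAt.comp z
      (h.hasFDerivAt_fderiv hz v)
  have h₁ : HasFDerivAt (isotropic X k) _ z := (hc 1).fun_sub ((hc I).const_mul I)
  have hL : D I I = -D 1 1 := by
    rw [eq_neg_iff_add_eq_zero, add_comm]
    exact h.laplacian_eq_zero hz
  have hs : D I 1 = D 1 I := h.fderiv_fderiv_symm hz I 1
  have hd : DifferentiableAt ℂ (isotropic X k) z := by
    rw [differentiableAt_complex_iff_differentiableAt_real]
    refine ⟨h₁.differentiableAt, ?_⟩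
    rw [h₁.fderiv]
    simp [← hD, hL, hs]
    -- the Cauchy-Riemann equation is `X_vv = -X_uu`
    linear_combination (D 1 I k : ℂ) * I_mul_I
  have h₂ := congrArg (fun T : ℂ →L[ℝ] ℂ => T 1)
    (hd.hasDerivAt.complexToReal_fderiv.unique h₁)
  have h₃ : deriv (isotropic X k) z = (D 1 1 k : ℂ) - I * (D 1 I k : ℂ) := by
    simpa [← hD] using h₂
  rw [← h₃]
  exact hd.hasDerivAt

theorem analyticOnNhd_isotropic (h : IsConformalMinimal X U) (k : Fin 3) :
    AnalyticOnNhd ℂ (isotropic X k) U :=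
  DifferentiableOn.analyticOnNhd
    (fun _ hz => (h.hasDerivAt_isotropic hz k).differentiableAt.differentiableWithinAt) h.isOpen

theorem analyticOnNhd_spinorSq (h : IsConformalMinimal X U) :
    AnalyticOnNhd ℂ (spinorSq X) U := fun z hz =>
  (h.analyticOnNhd_isotropic 0 z hz).fun_sub
    (analyticAt_const.fun_mul (h.analyticOnNhd_isotropic 1 z hz))

theorem analyticOnNhd_spinorSq' (h : IsConformalMinimal X U) :
    AnalyticOnNhd ℂ (spinorSq' X) U := fun z hz =>
  (h.analyticOnNhd_isotropic 0 z hz).fun_add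
    (analyticAt_const.fun_mul (h.analyticOnNhd_isotropic 1 z hz))

/-- The isotropy relation `φ_1² + φ_2² + φ_3² = 0`. -/
theorem spinorSq_mul_spinorSq' (h : IsConformalMinimal X U) (hz : z ∈ U) :
    spinorSq X z * spinorSq' X z = -isotropic X 2 z ^ 2 := by
  have h₁ := h.inner_du_dv hz
  have h₂ := h.inner_dv_dv hz
  rw [conformalFactor] at h₂
  rw [inner_E3] at h₁ h₂
  rw [inner_E3] at h₂
  apply Complex.ext
  · simp [spinorSq, spinorSq', isotropic, pow_two]
    linear_combination -h₂
  · simp [spinorSq, spinorSq', isotropic, pow_two]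
    linear_combination -2 * h₁

/-- The conformal factor is half of `|φ|²`. -/
theorem conformalFactor_eq (h : IsConformalMinimal X U) (hz : z ∈ U) :
    conformalFactor X z = 1 / 4 * (‖spinorSq X z‖ ^ 2 + ‖spinorSq' X z‖ ^ 2
      + 2 * ‖isotropic X 2 z‖ ^ 2) := by
  have h₂ := h.inner_dv_dv hz
  have h₃ : conformalFactor X z = _ := inner_E3 (fderiv ℝ X z 1) (fderiv ℝ X z 1)
  rw [inner_E3] at h₂
  simp only [← normSq_eq_norm_sq, normSq_apply]
  simp [spinorSq, spinorSq', isotropic]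
  linear_combination -1 / 2 * h₂ + 1 / 2 * h₃

theorem firstForm_weierstrass (h : IsConformalMinimal X U) (hz : z ∈ U) (h0 : spinorSq X z ≠ 0) :
    firstForm X z = (1 / 4 * ‖spinorSq X z‖ ^ 2 *
      (1 + ‖isotropic X 2 z / spinorSq X z‖ ^ 2) ^ 2) • (1 : Matrix (Fin 2) (Fin 2) ℝ) := by
  rw [h.firstForm_eq hz, h.conformalFactor_eq hz,
    weierstrass_conformalFactor h0 (h.spinorSq_mul_spinorSq' hz)]

theorem firstForm_weierstrass' (h : IsConformalMinimal X U) (hz : z ∈ U)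
    (h0 : spinorSq' X z ≠ 0) :
    firstForm X z = (1 / 4 * ‖spinorSq' X z‖ ^ 2 *
      (1 + ‖isotropic X 2 z / spinorSq' X z‖ ^ 2) ^ 2) • (1 : Matrix (Fin 2) (Fin 2) ℝ) := by
  rw [h.firstForm_eq hz, h.conformalFactor_eq hz, ← weierstrass_conformalFactor h0
    (by rw [mul_comm, h.spinorSq_mul_spinorSq' hz]), add_comm (‖spinorSq X z‖ ^ 2)]

theorem gaussMap_apply (h : IsConformalMinimal X U) (hz : z ∈ U) (k : Fin 3) :
    gaussMap X z k = (conformalFactor X z)⁻¹ * cross (fderiv ℝ X z 1) (fderiv ℝ X z I) k := by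
  rw [h.gaussMap_eq hz]
  rfl

/-- The pole `n_3 = 1` of the stereographic projection corresponds to a zero of `φ_1 - i φ_2`. -/
theorem norm_spinorSq_sq (h : IsConformalMinimal X U) (hz : z ∈ U) :
    ‖spinorSq X z‖ ^ 2 = conformalFactor X z * (1 - gaussMap X z 2) ^ 2 := by
  have hc := cross_two_sq_of_conformal rfl (h.inner_dv_dv hz) (h.inner_du_dv hz)
  have h₂ := h.inner_dv_dv hz
  have h₃ : conformalFactor X z = _ := inner_E3 (fderiv ℝ X z 1) (fderiv ℝ X z 1)
  have hE := (h.conformalFactor_pos hz).ne'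
  rw [inner_E3] at h₂
  rw [cross_two] at hc
  change _ = conformalFactor X z * (conformalFactor X z - _ - _) at hc
  rw [h.gaussMap_apply hz, cross_two]
  simp only [← normSq_eq_norm_sq, normSq_apply]
  simp [spinorSq, isotropic]
  set E := conformalFactor X z
  field_simp
  linear_combination E * h₂ - E * h₃ - hc

theorem norm_spinorSq'_sq (h : IsConformalMinimal X U) (hz : z ∈ U) :
    ‖spinorSq' X z‖ ^ 2 = conformalFactor X z * (1 + gaussMap X z 2) ^ 2 := by
  have hc := cross_two_sq_of_conformal rfl (h.inner_dv_dv hz) (h.inner_du_dv hz)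
  have h₂ := h.inner_dv_dv hz
  have h₃ : conformalFactor X z = _ := inner_E3 (fderiv ℝ X z 1) (fderiv ℝ X z 1)
  have hE := (h.conformalFactor_pos hz).ne'
  rw [inner_E3] at h₂
  rw [cross_two] at hc
  change _ = conformalFactor X z * (conformalFactor X z - _ - _) at hc
  rw [h.gaussMap_apply hz, cross_two]
  simp only [← normSq_eq_norm_sq, normSq_apply]
  simp [spinorSq', isotropic]
  set E := conformalFactor X z
  field_simp
  linear_combination E * h₂ - E * h₃ - hc

theorem spinorSq_eq_zero_iff (h : IsConformalMinimal X U) (hz : z ∈ U) :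
    spinorSq X z = 0 ↔ gaussMap X z 2 = 1 := by
  rw [← norm_eq_zero, ← sq_eq_zero_iff, h.norm_spinorSq_sq hz, mul_eq_zero, sq_eq_zero_iff,
    sub_eq_zero]
  simp [(h.conformalFactor_pos hz).ne', eq_comm]

theorem spinorSq'_ne_zero (h : IsConformalMinimal X U) (hz : z ∈ U) (h0 : spinorSq X z = 0) :
    spinorSq' X z ≠ 0 := by
  rw [← norm_ne_zero_iff, ← sq_eq_zero_iff.ne, h.norm_spinorSq'_sq hz,
    (h.spinorSq_eq_zero_iff hz).1 h0]
  have := h.conformalFactor_pos hz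
  positivity

/-- `(n_1 + i n_2) / (1 - n_3) = φ_3 / (φ_1 - i φ_2)`, without denominators. -/
theorem gaussMap_mul_spinorSq (h : IsConformalMinimal X U) (hz : z ∈ U) :
    ((gaussMap X z 0 : ℂ) + (gaussMap X z 1 : ℂ) * I) * spinorSq X z
      = (1 - (gaussMap X z 2 : ℂ)) * isotropic X 2 z := by
  have h₁ := h.inner_du_dv hz
  have h₂ := h.inner_dv_dv hz
  have h₃ : conformalFactor X z = _ := inner_E3 (fderiv ℝ X z 1) (fderiv ℝ X z 1)
  have hE := (h.conformalFactor_pos hz).ne'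
  rw [inner_E3] at h₁ h₂
  simp only [h.gaussMap_apply hz, cross_zero, cross_one, cross_two]
  set E := conformalFactor X z
  apply Complex.ext
  · simp [spinorSq, isotropic, -ofReal_mul, -ofReal_inv, -ofReal_sub]
    field_simp
    generalize fderiv ℝ X z 1 = p at *
    generalize fderiv ℝ X z I = q at *
    linear_combination p 2 * h₂ - q 2 * h₁
  · simp [spinorSq, isotropic, -ofReal_mul, -ofReal_inv, -ofReal_sub]
    field_simp
    generalize fderiv ℝ X z 1 = p at *
    generalize fderiv ℝ X z I = q at *
    linear_combination q 2 * h₃ + p 2 * h₁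

/-- The Gauss map is `φ_3 / (φ_1 - i φ_2)` after stereographic projection. -/
theorem stereo_gaussMap (h : IsConformalMinimal X U) (hz : z ∈ U) (h0 : spinorSq X z ≠ 0) :
    stereo (gaussMap X z) = ((isotropic X 2 z / spinorSq X z : ℂ) : OnePoint ℂ) := by
  have h₁ : gaussMap X z 2 ≠ 1 := fun e => h0 ((h.spinorSq_eq_zero_iff hz).2 e)
  have h₂ : 1 - ((gaussMap X z 2 : ℝ) : ℂ) ≠ 0 := by
    rw [sub_ne_zero]
    exact_mod_cast h₁.symm
  rw [stereo, if_neg h₁]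
  congr 1
  rw [div_eq_div_iff h₂ h0, h.gaussMap_mul_spinorSq hz, mul_comm]

theorem stereo_gaussMap_eq_infty_iff (h : IsConformalMinimal X U) (hz : z ∈ U) :
    stereo (gaussMap X z) = OnePoint.infty ↔ spinorSq X z = 0 := by
  constructor
  · intro e
    by_contra h0
    rw [h.stereo_gaussMap hz h0] at e
    exact OnePoint.coe_ne_infty _ e
  · intro h0
    rw [stereo, if_pos ((h.spinorSq_eq_zero_iff hz).1 h0)]

/-- The Hopf differential is `⟨φ', n⟩ dz²`. -/
theorem hopfDifferential_eq_sum (h : IsConformalMinimal X U) (hz : z ∈ U) :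
    hopfDifferential X z 1 1 = ∑ k, deriv (isotropic X k) z * (gaussMap X z k : ℂ) := by
  have e₃ : ∀ a b : ℂ, fderiv ℝ (fun w => fderiv ℝ X w b) z a
      = fderiv ℝ (fderiv ℝ X) z a b := fun a b => by
    rw [(h.hasFDerivAt_fderiv hz b).fderiv]
    rfl
  simp only [(h.hasDerivAt_isotropic hz _).deriv, Fin.sum_univ_three]
  simp [hopfDifferential, quadraticDifferential, toForm, secondForm, coord, coordVec,
    Fin.sum_univ_two, e₃, inner_E3, h.fderiv_fderiv_symm hz I 1]
  ring

/-- The Hopf differential is `-F G' dz²`, with `F = φ_1 - i φ_2`. In terms of `F` and `G`,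
`φ = F ((1 - G²)/2, i (1 + G²)/2, G)`, and `⟨φ, n⟩ = 0` and `⟨(-G, i G, 1), n⟩ = -1`. -/
theorem hopfDifferential_eq (h : IsConformalMinimal X U) (hz : z ∈ U) (h0 : spinorSq X z ≠ 0) :
    hopfDifferential X z 1 1
      = -(spinorSq X z * deriv (fun w => isotropic X 2 w / spinorSq X w) z) := by
  have d := fun k => (h.analyticOnNhd_isotropic k z hz).differentiableAt
  have dF := (h.analyticOnNhd_spinorSq z hz).differentiableAt
  have dF' := (h.analyticOnNhd_spinorSq' z hz).differentiableAt
  have hF : deriv (spinorSq X) z = deriv (isotropic X 0) z - I * deriv (isotropic X 1) z :=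
    ((d 0).hasDerivAt.fun_sub ((d 1).hasDerivAt.const_mul I)).deriv
  have hF' : deriv (spinorSq' X) z = deriv (isotropic X 0) z + I * deriv (isotropic X 1) z :=
    ((d 0).hasDerivAt.fun_add ((d 1).hasDerivAt.const_mul I)).deriv
  have hiso : deriv (spinorSq X) z * spinorSq' X z + spinorSq X z * deriv (spinorSq' X) z
      = -(2 * isotropic X 2 z * deriv (isotropic X 2) z) := by
    have e : (fun w => spinorSq X w * spinorSq' X w) =ᶠ[𝓝 z] fun w => -isotropic X 2 w ^ 2 :=
      Filter.eventuallyEq_of_mem (h.isOpen.mem_nhds hz) fun w hw => h.spinorSq_mul_spinorSq' hw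
    have := ((dF.hasDerivAt.fun_mul dF'.hasDerivAt).congr_of_eventuallyEq e.symm).unique
      ((d 2).hasDerivAt.fun_pow 2).fun_neg
    rw [this]
    push_cast
    ring
  have hu : (gaussMap X z 0) ^ 2 + (gaussMap X z 1) ^ 2 + (gaussMap X z 2) ^ 2 = 1 := by
    have hE := h.conformalFactor_pos hz
    have hc := norm_cross_of_conformal hE rfl (h.inner_dv_dv hz) (h.inner_du_dv hz)
    have : (inner ℝ (gaussMap X z) (gaussMap X z) : ℝ) = 1 := by
      rw [real_inner_self_eq_norm_sq, h.gaussMap_eq hz, norm_smul, hc, Real.norm_eq_abs,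
        abs_of_pos (inv_pos.2 hE), inv_mul_cancel₀ hE.ne', one_pow]
    rw [inner_E3] at this
    linear_combination this
  have hu' : ((gaussMap X z 0 : ℝ) : ℂ) ^ 2 + (gaussMap X z 1 : ℂ) ^ 2
      + (gaussMap X z 2 : ℂ) ^ 2 = 1 := by
    have := congrArg ofReal hu
    push_cast at this
    exact this
  have hst := h.gaussMap_mul_spinorSq hz
  have hmul := h.spinorSq_mul_spinorSq' hz
  have h1 : 1 - ((gaussMap X z 2 : ℝ) : ℂ) ≠ 0 := by
    rw [sub_ne_zero]
    exact_mod_cast fun e : 1 = gaussMap X z 2 => h0 ((h.spinorSq_eq_zero_iff hz).2 e.symm)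
  rw [h.hopfDifferential_eq_sum hz, Fin.sum_univ_three,
    ((d 2).hasDerivAt.fun_div dF.hasDerivAt h0).deriv]
  have h2 : deriv (isotropic X 0) z = (deriv (spinorSq X) z + deriv (spinorSq' X) z) / 2 := by
    rw [hF, hF']; ring
  have h3 : deriv (isotropic X 1) z = I * (deriv (spinorSq X) z - deriv (spinorSq' X) z) / 2 := by
    rw [hF, hF']; linear_combination deriv (isotropic X 1) z * I_sq
  rw [h2, h3]
  generalize (gaussMap X z 0 : ℂ) = a at *
  generalize (gaussMap X z 1 : ℂ) = b at *
  generalize (gaussMap X z 2 : ℂ) = c at *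
  generalize spinorSq X z = F at *
  generalize isotropic X 2 z = H at *
  generalize deriv (isotropic X 2) z = H' at *
  generalize deriv (spinorSq X) z = dF at *
  generalize deriv (spinorSq' X) z = dF' at *
  -- `t` is the value of `G`; the rest is algebra with `n = (a, b, c)` in terms of `t`
  obtain ⟨t, rfl⟩ : ∃ t, H = t * F := ⟨H / F, by field_simp⟩
  have hFt : spinorSq' X z = -t ^ 2 * F := mul_left_cancel₀ h0 (by rw [hmul]; ring)
  rw [hFt] at hiso
  have hdF' : dF' = t ^ 2 * dF - 2 * t * H' := mul_left_cancel₀ h0 (by linear_combination hiso)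
  have hN : a + b * I = t * (1 - c) := mul_right_cancel₀ h0 (by linear_combination hst)
  have hN' : t * (a - b * I) = 1 + c := mul_left_cancel₀ h1 (by
    linear_combination hu' - b ^ 2 * I_sq - (a - b * I) * hN)
  rw [hdF']
  field_simp
  linear_combination dF * hN + (t * dF - 2 * H') * hN'

end IsConformalMinimal

/-! ### Expressions for the entropy coefficient -/

section Coefficient

variable {F G H : ℂ → ℂ} {z : ℂ}

theorem analyticAt_logDeriv (hF : AnalyticAt ℂ F z) (h0 : F z ≠ 0) :
    AnalyticAt ℂ (logDeriv F) z := hF.deriv.div hF h0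

theorem deriv_logDeriv (hF : AnalyticAt ℂ F z) (h0 : F z ≠ 0) :
    deriv (logDeriv F) z = iteratedDeriv 2 F z / F z - (deriv F z / F z) ^ 2 := by
  have h := (hF.deriv.differentiableAt.hasDerivAt.div hF.differentiableAt.hasDerivAt h0).deriv
  rw [logDeriv, h]
  simp only [iteratedDeriv_succ, iteratedDeriv_zero]
  field_simp

theorem logDeriv_add_eventuallyEq (hF : AnalyticAt ℂ F z) (hG : AnalyticAt ℂ G z)
    (hF0 : F z ≠ 0) (hG0 : G z ≠ 0) (h : ∀ᶠ w in 𝓝 z, F w * G w = H w) :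
    (fun w => logDeriv F w + logDeriv G w) =ᶠ[𝓝 z] logDeriv H := by
  filter_upwards [hF.eventually_analyticAt, hG.eventually_analyticAt,
    hF.continuousAt.eventually_ne hF0, hG.continuousAt.eventually_ne hG0,
    h.eventually_nhds] with w h₁ h₂ h₃ h₄ h₅
  rw [← logDeriv_mul w h₃ h₄ h₁.differentiableAt h₂.differentiableAt, logDeriv_apply,
    logDeriv_apply, Filter.EventuallyEq.deriv_eq h₅, h₅.self_of_nhds]

theorem entropyCoeff_congr {G₁ G₂ : ℂ → ℂ} (h : G₁ =ᶠ[𝓝 z] G₂) :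
    entropyCoeff F G₁ z = entropyCoeff F G₂ z := by
  have h₁ : logDeriv (deriv G₁) =ᶠ[𝓝 z] logDeriv (deriv G₂) := h.deriv.deriv.div h.deriv
  rw [entropyCoeff, entropyCoeff, h₁.deriv_eq, h₁.self_of_nhds]

theorem analyticAt_entropyCoeff (hF : AnalyticAt ℂ F z) (hG : AnalyticAt ℂ G z) (hF0 : F z ≠ 0)
    (hG0 : deriv G z ≠ 0) : AnalyticAt ℂ (entropyCoeff F G) z := by
  have h₁ := analyticAt_logDeriv hF hF0
  have h₂ := analyticAt_logDeriv hG.deriv hG0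
  have h₃ := h₁.deriv
  have h₄ := h₂.deriv
  unfold entropyCoeff
  fun_prop

theorem entropyCoeff_eq_rhoExpr (hF : AnalyticAt ℂ F z) (hG : AnalyticAt ℂ G z) (hF0 : F z ≠ 0)
    (hG0 : G z ≠ 0) (hG1 : deriv G z ≠ 0) (h : ∀ᶠ w in 𝓝 z, F w * G w = H w) :
    entropyCoeff F G z = rhoExpr G H z := by
  have hH : AnalyticAt ℂ H z := (hF.fun_mul hG).congr h
  have hH0 : H z ≠ 0 := h.self_of_nhds ▸ mul_ne_zero hF0 hG0
  have e := logDeriv_add_eventuallyEq hF hG hF0 hG0 h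
  have e₁ := e.self_of_nhds
  have e₂ := e.deriv_eq
  rw [deriv_fun_add (analyticAt_logDeriv hF hF0).differentiableAt
    (analyticAt_logDeriv hG hG0).differentiableAt, deriv_logDeriv hG hG0,
    deriv_logDeriv hH hH0] at e₂
  have e₃ : iteratedDeriv 2 (deriv G) z = iteratedDeriv 3 G z := by
    rw [iteratedDeriv_succ' (n := 2)]
  have e₄ : deriv (deriv G) z = iteratedDeriv 2 G z := by
    simp only [iteratedDeriv_succ, iteratedDeriv_zero]
  rw [entropyCoeff, rhoExpr, eq_sub_of_add_eq e₂, eq_sub_of_add_eq e₁,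
    deriv_logDeriv hG.deriv hG1, logDeriv_apply, logDeriv_apply, logDeriv_apply, e₃, e₄]
  field_simp
  ring

/-- If `F G'` is constant, then `F'/F = -G''/G'`, and the coefficient is twice the Schwarzian. -/
theorem entropyCoeff_of_mul_deriv_const (hF : AnalyticAt ℂ F z) (hG : AnalyticAt ℂ G z)
    (hF0 : F z ≠ 0) (hG1 : deriv G z ≠ 0) {c : ℂ} (h : ∀ᶠ w in 𝓝 z, F w * deriv G w = c) :
    entropyCoeff F G z / 2 = deriv (fun t => iteratedDeriv 2 G t / deriv G t) z
      - 1 / 2 * (iteratedDeriv 2 G z / deriv G z) ^ 2 := by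
  have e := logDeriv_add_eventuallyEq hF hG.deriv hF0 hG1 h
  have hl : logDeriv (deriv G) = fun t => iteratedDeriv 2 G t / deriv G t := by
    ext t
    simp only [logDeriv_apply, iteratedDeriv_succ, iteratedDeriv_zero]
  have hc : logDeriv (fun _ : ℂ => c) = fun _ => 0 := by
    ext t
    simp [logDeriv_apply]
  rw [hc] at e
  have e₁ : logDeriv F z + logDeriv (deriv G) z = 0 := e.self_of_nhds
  have e₂ := e.deriv_eq
  rw [deriv_fun_add (analyticAt_logDeriv hF hF0).differentiableAt
    (analyticAt_logDeriv hG.deriv hG1).differentiableAt, deriv_const] at e₂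
  rw [entropyCoeff, eq_neg_of_add_eq_zero_left e₁, eq_neg_of_add_eq_zero_left e₂, ← hl]
  change _ = _ - 1 / 2 * ((fun t => iteratedDeriv 2 G t / deriv G t) z) ^ 2
  rw [← hl]
  ring

theorem schwarzian_eq (hG : AnalyticAt ℂ G z) (hG1 : deriv G z ≠ 0) :
    schwarzian G z = deriv (fun t => iteratedDeriv 2 G t / deriv G t) z
      - 1 / 2 * (iteratedDeriv 2 G z / deriv G z) ^ 2 := by
  have hl : (fun t => iteratedDeriv 2 G t / deriv G t) = logDeriv (deriv G) := by
    ext t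
    simp only [logDeriv_apply, iteratedDeriv_succ, iteratedDeriv_zero]
  have e₃ : iteratedDeriv 2 (deriv G) z = iteratedDeriv 3 G z := by
    rw [iteratedDeriv_succ' (n := 2)]
  have e₄ : deriv (deriv G) z = iteratedDeriv 2 G z := by
    simp only [iteratedDeriv_succ, iteratedDeriv_zero]
  rw [hl, deriv_logDeriv hG.deriv hG1, e₃, e₄, schwarzian]
  ring

end Coefficient

theorem deriv_ne_zero_of_gaussCurvature_neg {V : Set ℂ} {F G : ℂ → ℂ} {g : TensorField}
    (hV : IsOpen V) (hF : AnalyticOnNhd ℂ F V)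
    (hG : AnalyticOnNhd ℂ G V) (hF0 : ∀ z ∈ V, F z ≠ 0)
    (hg : ∀ z ∈ V, g z = (1 / 4 * ‖F z‖ ^ 2 * (1 + ‖G z‖ ^ 2) ^ 2) •
      (1 : Matrix (Fin 2) (Fin 2) ℝ)) {z : ℂ} (hz : z ∈ V) (hK : gaussCurvature g z < 0) :
    deriv G z ≠ 0 := by
  intro h0
  rw [gaussCurvature_weierstrass hV hF hG hF0 hg hz, h0] at hK
  simp at hK

/-! ### The entropy differential of a conformal minimal immersion -/

/-- The meromorphic function `G = φ_3 / (φ_1 - i φ_2)`. -/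
noncomputable def gaussFun (X : ℂ → E3) (z : ℂ) : ℂ := isotropic X 2 z / spinorSq X z

/-- The function `-1 / G = φ_3 / (φ_1 + i φ_2)`, which is finite at the poles of `G`. -/
noncomputable def gaussFun' (X : ℂ → E3) (z : ℂ) : ℂ := isotropic X 2 z / spinorSq' X z

/-- The coefficient `ρ` in `P = (ρ / 2) dz²`. -/
noncomputable def rho (X : ℂ → E3) (z : ℂ) : ℂ := 2 * entropyDifferential (firstForm X) z 1 1

namespace IsConformalMinimal

variable {X : ℂ → E3} {U : Set ℂ} {z : ℂ}

theorem isOpen_regular (h : IsConformalMinimal X U) : IsOpen {z | z ∈ U ∧ spinorSq X z ≠ 0} :=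
  h.analyticOnNhd_spinorSq.continuousOn.isOpen_inter_preimage h.isOpen isOpen_compl_singleton

theorem isOpen_regular' (h : IsConformalMinimal X U) : IsOpen {z | z ∈ U ∧ spinorSq' X z ≠ 0} :=
  h.analyticOnNhd_spinorSq'.continuousOn.isOpen_inter_preimage h.isOpen isOpen_compl_singleton

theorem analyticOnNhd_gaussFun (h : IsConformalMinimal X U) :
    AnalyticOnNhd ℂ (gaussFun X) {z | z ∈ U ∧ spinorSq X z ≠ 0} := fun z hz =>
  (h.analyticOnNhd_isotropic 2 z hz.1).fun_div (h.analyticOnNhd_spinorSq z hz.1) hz.2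

theorem analyticOnNhd_gaussFun' (h : IsConformalMinimal X U) :
    AnalyticOnNhd ℂ (gaussFun' X) {z | z ∈ U ∧ spinorSq' X z ≠ 0} := fun z hz =>
  (h.analyticOnNhd_isotropic 2 z hz.1).fun_div (h.analyticOnNhd_spinorSq' z hz.1) hz.2

theorem deriv_gaussFun_ne_zero (h : IsConformalMinimal X U) (hz : z ∈ U)
    (hK : gaussCurvature (firstForm X) z < 0) (h0 : spinorSq X z ≠ 0) :
    deriv (gaussFun X) z ≠ 0 :=
  deriv_ne_zero_of_gaussCurvature_neg h.isOpen_regular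
    (fun w hw => h.analyticOnNhd_spinorSq w hw.1) h.analyticOnNhd_gaussFun (fun _ hw => hw.2)
    (fun _ hw => h.firstForm_weierstrass hw.1 hw.2) ⟨hz, h0⟩ hK

theorem deriv_gaussFun'_ne_zero (h : IsConformalMinimal X U) (hz : z ∈ U)
    (hK : gaussCurvature (firstForm X) z < 0) (h0 : spinorSq' X z ≠ 0) :
    deriv (gaussFun' X) z ≠ 0 :=
  deriv_ne_zero_of_gaussCurvature_neg h.isOpen_regular'
    (fun w hw => h.analyticOnNhd_spinorSq' w hw.1) h.analyticOnNhd_gaussFun' (fun _ hw => hw.2)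
    (fun _ hw => h.firstForm_weierstrass' hw.1 hw.2) ⟨hz, h0⟩ hK

theorem entropyDifferential_eq (h : IsConformalMinimal X U)
    (hK : ∀ z ∈ U, gaussCurvature (firstForm X) z < 0) (hz : z ∈ U) (h0 : spinorSq X z ≠ 0)
    (v w : ℂ) : entropyDifferential (firstForm X) z v w
      = entropyCoeff (spinorSq X) (gaussFun X) z / 2 * (v * w) :=
  entropyDifferential_weierstrass h.isOpen_regular
    (fun w hw => h.analyticOnNhd_spinorSq w hw.1) h.analyticOnNhd_gaussFun (fun _ hw => hw.2)
    (fun w hw => h.deriv_gaussFun_ne_zero hw.1 (hK w hw.1) hw.2)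
    (fun _ hw => h.firstForm_weierstrass hw.1 hw.2) ⟨hz, h0⟩ v w

theorem entropyDifferential_eq' (h : IsConformalMinimal X U)
    (hK : ∀ z ∈ U, gaussCurvature (firstForm X) z < 0) (hz : z ∈ U) (h0 : spinorSq' X z ≠ 0)
    (v w : ℂ) : entropyDifferential (firstForm X) z v w
      = entropyCoeff (spinorSq' X) (gaussFun' X) z / 2 * (v * w) :=
  entropyDifferential_weierstrass h.isOpen_regular'
    (fun w hw => h.analyticOnNhd_spinorSq' w hw.1) h.analyticOnNhd_gaussFun' (fun _ hw => hw.2)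
    (fun w hw => h.deriv_gaussFun'_ne_zero hw.1 (hK w hw.1) hw.2)
    (fun _ hw => h.firstForm_weierstrass' hw.1 hw.2) ⟨hz, h0⟩ v w

theorem rho_eq (h : IsConformalMinimal X U)
    (hK : ∀ z ∈ U, gaussCurvature (firstForm X) z < 0) (hz : z ∈ U) (h0 : spinorSq X z ≠ 0) :
    rho X z = entropyCoeff (spinorSq X) (gaussFun X) z := by
  rw [rho, h.entropyDifferential_eq hK hz h0]
  ring

theorem rho_eq' (h : IsConformalMinimal X U)
    (hK : ∀ z ∈ U, gaussCurvature (firstForm X) z < 0) (hz : z ∈ U) (h0 : spinorSq' X z ≠ 0) :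
    rho X z = entropyCoeff (spinorSq' X) (gaussFun' X) z := by
  rw [rho, h.entropyDifferential_eq' hK hz h0]
  ring

theorem entropyDifferential_eq_rho (h : IsConformalMinimal X U)
    (hK : ∀ z ∈ U, gaussCurvature (firstForm X) z < 0) (hz : z ∈ U) (v w : ℂ) :
    entropyDifferential (firstForm X) z v w = rho X z / 2 * (v * w) := by
  by_cases h0 : spinorSq X z = 0
  · have h1 := h.spinorSq'_ne_zero hz h0
    rw [h.entropyDifferential_eq' hK hz h1, h.rho_eq' hK hz h1]
  · rw [h.entropyDifferential_eq hK hz h0, h.rho_eq hK hz h0]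

theorem analyticOnNhd_rho (h : IsConformalMinimal X U)
    (hK : ∀ z ∈ U, gaussCurvature (firstForm X) z < 0) : AnalyticOnNhd ℂ (rho X) U := by
  intro z hz
  by_cases h0 : spinorSq X z = 0
  · have h1 := h.spinorSq'_ne_zero hz h0
    refine (analyticAt_entropyCoeff (h.analyticOnNhd_spinorSq' z hz)
      (h.analyticOnNhd_gaussFun' z ⟨hz, h1⟩) h1
      (h.deriv_gaussFun'_ne_zero hz (hK z hz) h1)).congr ?_
    filter_upwards [h.isOpen_regular'.mem_nhds ⟨hz, h1⟩] with w hw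
    exact (h.rho_eq' hK hw.1 hw.2).symm
  · refine (analyticAt_entropyCoeff (h.analyticOnNhd_spinorSq z hz)
      (h.analyticOnNhd_gaussFun z ⟨hz, h0⟩) h0
      (h.deriv_gaussFun_ne_zero hz (hK z hz) h0)).congr ?_
    filter_upwards [h.isOpen_regular.mem_nhds ⟨hz, h0⟩] with w hw
    exact (h.rho_eq hK hw.1 hw.2).symm

theorem isotropic_eq_zero (h : IsConformalMinimal X U) (hz : z ∈ U) (h0 : spinorSq X z = 0) :
    isotropic X 2 z = 0 := by
  have := h.spinorSq_mul_spinorSq' hz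
  rw [h0, zero_mul, eq_comm, neg_eq_zero] at this
  exact pow_eq_zero_iff two_ne_zero |>.1 this

/-- Negative curvature makes the zeros and the poles of `G` simple, so that they are isolated.
They are the zeros of `φ_3`. -/
theorem eventually_isotropic_ne_zero (h : IsConformalMinimal X U)
    (hK : ∀ z ∈ U, gaussCurvature (firstForm X) z < 0) (hz : z ∈ U) :
    ∀ᶠ w in 𝓝[≠] z, isotropic X 2 w ≠ 0 := by
  by_cases h0 : spinorSq X z = 0
  · have h1 := h.spinorSq'_ne_zero hz h0
    have := (h.analyticOnNhd_gaussFun' z ⟨hz, h1⟩).differentiableAt.hasDerivAt.eventually_ne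
      (c := 0) (h.deriv_gaussFun'_ne_zero hz (hK z hz) h1)
    filter_upwards [this] with w hw e
    exact hw (by rw [gaussFun', e, zero_div])
  · have := (h.analyticOnNhd_gaussFun z ⟨hz, h0⟩).differentiableAt.hasDerivAt.eventually_ne
      (c := 0) (h.deriv_gaussFun_ne_zero hz (hK z hz) h0)
    filter_upwards [this] with w hw e
    exact hw (by rw [gaussFun, e, zero_div])

end IsConformalMinimal

/-! ### Charts of the Riemann surface -/

section Chart

variable {M : Type*} [TopologicalSpace M] [ChartedSpace ℂ M]
  {x : M → E3} {G : M → OnePoint ℂ} {η : (p : M) → TangentSpace 𝓘(ℂ) p →L[ℂ] ℂ}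
  {e : OpenPartialHomeomorph M ℂ} {z : ℂ}

theorem IsMinimalImmersion.isConformalMinimal (hx : IsMinimalImmersion x)
    (he : e ∈ holoCharts M) : IsConformalMinimal (localParam x e) e.target where
  isOpen := e.open_target
  smooth := hx.smooth e he
  immersion := hx.immersion e he
  conformal := hx.conformal e he
  minimal := hx.minimal e he

theorem IsWeierstrassData.heightCoeff_eq (hW : IsWeierstrassData x G η)
    (he : e ∈ holoCharts M) (hz : z ∈ e.target) :
    heightCoeff η e z = isotropic (localParam x e) 2 z := by
  have h₁ := hW.height e he z hz 1
  have h₂ := hW.height e he z hz I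
  have h₃ : η (e.symm z) (mfderiv 𝓘(ℂ) 𝓘(ℂ) e.symm z (I : ℂ)) = I * heightCoeff η e z := by
    have := ((η (e.symm z)).comp (mfderiv 𝓘(ℂ) 𝓘(ℂ) e.symm z)).map_smul I (1 : ℂ)
    have hI : η (e.symm z) (mfderiv 𝓘(ℂ) 𝓘(ℂ) e.symm z (I * 1 : ℂ))
        = I * heightCoeff η e z := this
    rwa [mul_one] at hI
  rw [h₃] at h₂
  change _ = (heightCoeff η e z).re at h₁
  apply Complex.ext
  · simp [isotropic, h₁]
  · simp [isotropic, h₂]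

theorem IsWeierstrassData.eq_infty_iff (hW : IsWeierstrassData x G η) (hx : IsMinimalImmersion x)
    (he : e ∈ holoCharts M) (hz : z ∈ e.target) :
    G (e.symm z) = OnePoint.infty ↔ spinorSq (localParam x e) z = 0 := by
  rw [hW.gauss e he z hz, (hx.isConformalMinimal he).stereo_gaussMap_eq_infty_iff hz]

theorem IsWeierstrassData.eq_gaussFun (hW : IsWeierstrassData x G η) (hx : IsMinimalImmersion x)
    (he : e ∈ holoCharts M) (hz : z ∈ e.target) (h0 : spinorSq (localParam x e) z ≠ 0) :
    G (e.symm z) = (gaussFun (localParam x e) z : OnePoint ℂ) := by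
  rw [hW.gauss e he z hz, (hx.isConformalMinimal he).stereo_gaussMap hz h0]
  rfl

theorem IsWeierstrassData.localGauss_eventuallyEq (hW : IsWeierstrassData x G η)
    (hx : IsMinimalImmersion x) (he : e ∈ holoCharts M) (hz : z ∈ e.target)
    (h0 : spinorSq (localParam x e) z ≠ 0) :
    localGauss G e =ᶠ[𝓝 z] gaussFun (localParam x e) := by
  filter_upwards [(hx.isConformalMinimal he).isOpen_regular.mem_nhds ⟨hz, h0⟩] with w hw
  rw [localGauss, hW.eq_gaussFun hx he hw.1 hw.2]
  rfl

end Chart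

end EntropyDiff

/-! ### The entropy differential in Weierstrass data -/

theorem mainTheorem6 {M : Type*} [TopologicalSpace M] [ChartedSpace ℂ M] [IsManifold 𝓘(ℂ) ω M]
    (x : M → EntropyDiff.E3) (G : M → OnePoint ℂ) (η : (p : M) → TangentSpace 𝓘(ℂ) p →L[ℂ] ℂ)
    (hx : EntropyDiff.IsMinimalImmersion x) (hW : EntropyDiff.IsWeierstrassData x G η)
    (e : OpenPartialHomeomorph M ℂ) (he : e ∈ EntropyDiff.holoCharts M)
    (hK : ∀ z ∈ e.target,
      EntropyDiff.gaussCurvature (EntropyDiff.firstForm (EntropyDiff.localParam x e)) z < 0) :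
    -- the derivatives in the formulas are genuine, and the denominators do not vanish
    -- away from the zeros and poles of `G`, which are isolated
    (∀ z ∈ e.target, AnalyticAt ℂ (EntropyDiff.heightCoeff η e) z) ∧
    (∀ z ∈ e.target, G (e.symm z) ≠ OnePoint.infty →
      AnalyticAt ℂ (EntropyDiff.localGauss G e) z ∧
        deriv (EntropyDiff.localGauss G e) z ≠ 0) ∧
    (∀ z ∈ e.target, G (e.symm z) ≠ OnePoint.infty → G (e.symm z) ≠ ((0 : ℂ) : OnePoint ℂ) →
      EntropyDiff.heightCoeff η e z ≠ 0) ∧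
    (∀ z ∈ e.target, ∀ᶠ w in 𝓝[≠] z,
      G (e.symm w) ≠ OnePoint.infty ∧ G (e.symm w) ≠ ((0 : ℂ) : OnePoint ℂ)) ∧
    ∃ ρ : ℂ → ℂ,
      -- `P = (ρ / 2) dz²` with `ρ` holomorphic
      AnalyticOnNhd ℂ ρ e.target ∧
      (∀ z ∈ e.target, ∀ v w : ℂ,
        EntropyDiff.entropyDifferential (EntropyDiff.firstForm (EntropyDiff.localParam x e)) z v w
          = ρ z / 2 * (v * w)) ∧
      -- `ρ` is the rational expression, as an identity of meromorphic functions
      (∀ z ∈ e.target, G (e.symm z) ≠ OnePoint.infty → G (e.symm z) ≠ ((0 : ℂ) : OnePoint ℂ) →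
        ρ z = EntropyDiff.rhoExpr (EntropyDiff.localGauss G e) (EntropyDiff.heightCoeff η e) z) ∧
      (∀ z ∈ e.target, Filter.Tendsto
        (EntropyDiff.rhoExpr (EntropyDiff.localGauss G e) (EntropyDiff.heightCoeff η e))
        (𝓝[≠] z) (𝓝 (ρ z))) ∧
      -- if `Q = dz²`, then `P` is the Schwarzian derivative of `G`
      ((∀ z ∈ e.target, ∀ v w : ℂ,
          EntropyDiff.hopfDifferential (EntropyDiff.localParam x e) z v w = v * w) →
        (∀ z ∈ e.target, G (e.symm z) ≠ OnePoint.infty → ∀ v w : ℂ,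
          EntropyDiff.entropyDifferential
              (EntropyDiff.firstForm (EntropyDiff.localParam x e)) z v w
            = (deriv (fun t => iteratedDeriv 2 (EntropyDiff.localGauss G e) t
                  / deriv (EntropyDiff.localGauss G e) t) z
                - 1 / 2 * (iteratedDeriv 2 (EntropyDiff.localGauss G e) z
                  / deriv (EntropyDiff.localGauss G e) z) ^ 2) * (v * w) ∧
          EntropyDiff.entropyDifferential
              (EntropyDiff.firstForm (EntropyDiff.localParam x e)) z v w
            = EntropyDiff.schwarzian (EntropyDiff.localGauss G e) z * (v * w)) ∧
        (∀ z ∈ e.target, Filter.Tendsto (EntropyDiff.schwarzian (EntropyDiff.localGauss G e))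
          (𝓝[≠] z) (𝓝 (ρ z / 2)))) := by
  have hX := hx.isConformalMinimal he
  set X := EntropyDiff.localParam x e
  have hmem : ∀ z ∈ e.target, e.target ∈ 𝓝 z := fun z hz => e.open_target.mem_nhds hz
  have hh : ∀ z ∈ e.target,
      EntropyDiff.heightCoeff η e =ᶠ[𝓝 z] EntropyDiff.isotropic X 2 := fun z hz =>
    Filter.eventuallyEq_of_mem (hmem z hz) fun w hw => hW.heightCoeff_eq he hw
  have hfin : ∀ z ∈ e.target, G (e.symm z) ≠ OnePoint.infty → EntropyDiff.spinorSq X z ≠ 0 :=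
    fun z hz h => (hW.eq_infty_iff hx he hz).not.1 h
  have hnz : ∀ z ∈ e.target, G (e.symm z) ≠ OnePoint.infty →
      G (e.symm z) ≠ ((0 : ℂ) : OnePoint ℂ) → EntropyDiff.isotropic X 2 z ≠ 0 := by
    intro z hz h₁ h₂ h₃
    rw [hW.eq_gaussFun hx he hz (hfin z hz h₁), EntropyDiff.gaussFun, h₃,
      zero_div] at h₂
    exact h₂ rfl
  have hG : ∀ z ∈ e.target, G (e.symm z) ≠ OnePoint.infty →
      AnalyticAt ℂ (EntropyDiff.localGauss G e) z ∧
        deriv (EntropyDiff.localGauss G e) z ≠ 0 := by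
    intro z hz h
    have h0 := hfin z hz h
    have hE := hW.localGauss_eventuallyEq hx he hz h0
    refine ⟨(hX.analyticOnNhd_gaussFun z ⟨hz, h0⟩).congr hE.symm, ?_⟩
    rw [hE.deriv_eq]
    exact hX.deriv_gaussFun_ne_zero hz (hK z hz) h0
  -- near a point that is not a pole, `F G = h`
  have hFG : ∀ z ∈ e.target, G (e.symm z) ≠ OnePoint.infty → ∀ᶠ w in 𝓝 z,
      EntropyDiff.spinorSq X w * EntropyDiff.localGauss G e w =
        EntropyDiff.heightCoeff η e w := by
    intro z hz h
    have h0 := hfin z hz h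
    filter_upwards [hh z hz, hW.localGauss_eventuallyEq hx he hz h0,
      hX.isOpen_regular.mem_nhds ⟨hz, h0⟩] with w h₁ h₂ h₃
    rw [h₁, h₂, EntropyDiff.gaussFun, mul_div_cancel₀ _ h₃.2]
  have hρ : ∀ z ∈ e.target, G (e.symm z) ≠ OnePoint.infty →
      EntropyDiff.rho X z =
        EntropyDiff.entropyCoeff (EntropyDiff.spinorSq X) (EntropyDiff.localGauss G e) z := by
    intro z hz h
    have h0 := hfin z hz h
    have hE := hW.localGauss_eventuallyEq hx he hz h0
    rw [hX.rho_eq hK hz h0, EntropyDiff.entropyCoeff_congr hE]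
  have hrho : ∀ z ∈ e.target, G (e.symm z) ≠ OnePoint.infty →
      G (e.symm z) ≠ ((0 : ℂ) : OnePoint ℂ) →
      EntropyDiff.rho X z =
        EntropyDiff.rhoExpr (EntropyDiff.localGauss G e) (EntropyDiff.heightCoeff η e) z := by
    intro z hz h₁ h₂
    have h0 := hfin z hz h₁
    obtain ⟨ha, hd⟩ := hG z hz h₁
    have hF := hFG z hz h₁
    have hG0 : EntropyDiff.localGauss G e z ≠ 0 := by
      intro h
      have := hF.self_of_nhds
      rw [h, mul_zero, (hh z hz).self_of_nhds] at this
      exact hnz z hz h₁ h₂ this.symm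
    rw [hρ z hz h₁, EntropyDiff.entropyCoeff_eq_rhoExpr (hX.analyticOnNhd_spinorSq z hz) ha h0 hG0
      hd hF]
  have hiso : ∀ z ∈ e.target, ∀ᶠ w in 𝓝[≠] z, w ∈ e.target ∧
      G (e.symm w) ≠ OnePoint.infty ∧ G (e.symm w) ≠ ((0 : ℂ) : OnePoint ℂ) := by
    intro z hz
    filter_upwards [hX.eventually_isotropic_ne_zero hK hz,
      nhdsWithin_le_nhds (hmem z hz)] with w h₁ h₂
    have h0 : EntropyDiff.spinorSq X w ≠ 0 := fun h => h₁ (hX.isotropic_eq_zero h₂ h)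
    refine ⟨h₂, (hW.eq_infty_iff hx he h₂).not.2 h0, ?_⟩
    rw [hW.eq_gaussFun hx he h₂ h0]
    exact fun h => div_ne_zero h₁ h0 (OnePoint.coe_injective h)
  have han := hX.analyticOnNhd_rho hK
  have hlim : ∀ z ∈ e.target, Filter.Tendsto (EntropyDiff.rho X) (𝓝[≠] z)
      (𝓝 (EntropyDiff.rho X z)) := fun z hz =>
    (han z hz).continuousAt.tendsto.mono_left nhdsWithin_le_nhds
  refine ⟨fun z hz => (hX.analyticOnNhd_isotropic 2 z hz).congr (hh z hz).symm, hG,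
    fun z hz h₁ h₂ => by
      rw [(hh z hz).self_of_nhds]
      exact hnz z hz h₁ h₂,
    fun z hz => (hiso z hz).mono fun w hw => hw.2, EntropyDiff.rho X, han,
    fun z hz v w => hX.entropyDifferential_eq_rho hK hz v w, hrho, fun z hz => ?_, fun hQ => ?_⟩
  · refine (hlim z hz).congr' ?_
    filter_upwards [hiso z hz] with w hw
    exact hrho w hw.1 hw.2.1 hw.2.2
  -- the hypothesis `Q = dz²` says that `F G' = -1`
  have hFG' : ∀ z ∈ e.target, G (e.symm z) ≠ OnePoint.infty → ∀ᶠ w in 𝓝 z,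
      EntropyDiff.spinorSq X w * deriv (EntropyDiff.localGauss G e) w = -1 := by
    intro z hz h
    have h0 := hfin z hz h
    filter_upwards [hX.isOpen_regular.mem_nhds ⟨hz, h0⟩] with w hw
    have h₁ := hX.hopfDifferential_eq hw.1 hw.2
    rw [hQ w hw.1] at h₁
    rw [(hW.localGauss_eventuallyEq hx he hw.1 hw.2).deriv_eq]
    change EntropyDiff.spinorSq X w *
      deriv (fun t => EntropyDiff.isotropic X 2 t / EntropyDiff.spinorSq X t) w = -1
    linear_combination h₁
  have hS : ∀ z ∈ e.target, G (e.symm z) ≠ OnePoint.infty →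
      EntropyDiff.rho X z / 2 =
        deriv (fun t => iteratedDeriv 2 (EntropyDiff.localGauss G e) t
            / deriv (EntropyDiff.localGauss G e) t) z
          - 1 / 2 * (iteratedDeriv 2 (EntropyDiff.localGauss G e) z
            / deriv (EntropyDiff.localGauss G e) z) ^ 2 := by
    intro z hz h
    obtain ⟨ha, hd⟩ := hG z hz h
    rw [hρ z hz h, EntropyDiff.entropyCoeff_of_mul_deriv_const (hX.analyticOnNhd_spinorSq z hz) ha
      (hfin z hz h) hd (hFG' z hz h)]
  refine ⟨fun z hz h v w => ?_, fun z hz => ?_⟩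
  · obtain ⟨ha, hd⟩ := hG z hz h
    rw [EntropyDiff.schwarzian_eq ha hd, ← hS z hz h]
    exact ⟨hX.entropyDifferential_eq_rho hK hz v w, hX.entropyDifferential_eq_rho hK hz v w⟩
  · refine ((hlim z hz).div_const 2).congr' ?_
    filter_upwards [hiso z hz] with w hw
    obtain ⟨ha, hd⟩ := hG w hw.1 hw.2.1
    rw [EntropyDiff.schwarzian_eq ha hd, hS w hw.1 hw.2.1]
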